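/- **Theorem.** Let $d\ge 1$, let $\Omega\subseteq\mathbb R^d$ be a (non-empty) open connected set, and let $\alpha\ge 0$. Let $a,b:\Omega\to\mathbb R$ be measurable functions such that $a\in L^\infty(\Omega)$, $b\in L^\infty_{\mathrm{loc}}(\Omega)$ and $b_{\min}:=\operatorname{ess\,inf}_\Omega b>-\infty$; put $a_{\min}:=\operatorname{ess\,inf}_\Omega a$. Let $L^2(\Omega)$ be the space of complex-valued square-integrable functions with norm $\|\cdot\|$ and inner product $(\cdot,\cdot)$, antilinear in the first argument. Let $D(s_0)$ be the completion of $C_0^\infty(\Omega)$ with respect to the norm $$\|\psi\|_{s_0}^2:=\|\psi\|^2+\|\nabla\psi\|^2+\|(b-b_{\min})^{1/2}\psi\|^2,$$ regarded as a subspace of $L^2(\Omega)$, and on $D(s_0)$ consider the form $s_0(\varphi,\psi):=(\nabla\varphi,\nabla\psi)+(\varphi,b\psi)$. Let $S_0$ be the operator in $L^2(\Omega)$ associated with $s_0$ (that is, $-\Delta+b$ with Dirichlet boundary conditions): $\psi\in D(s_0)$ belongs to $D(S_0)$, with $S_0\psi=f$, if and only if $f\in L^2(\Omega)$ and $s_0(\varphi,\psi)=(\varphi,f)$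 for all $\varphi\in D(s_0)$. On the Hilbert space $\mathcal H:=D(s_0)\times L^2(\Omega)$ with norm $\|\{\psi_1,\psi_2\}\|_{\mathcal H}^2:=\|\psi_1\|_{s_0}^2+\|\psi_2\|^2$ define the operator $$A_\alpha\{\psi_1,\psi_2\}:=\{\psi_2,\,-S_0\psi_1-\alpha a\psi_2\},\qquad D(A_\alpha):=D(S_0)\times D(s_0).$$ Then $A_\alpha$ is the infinitesimal generator of a $C_0$-semigroup $U_\alpha$ of bounded operators on $\mathcal H$, and $$\|U_\alpha(t)\|\le e^{\omega_\alpha t}\quad\text{for all } t\in(0,\infty),\qquad \omega_\alpha:=2\bigl(1+\alpha|a_{\min}|+|b_{\min}|\bigr).$$ -/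

import Mathlib

open MeasureTheory Filter Topology TopologicalSpace
open scoped NNReal ENNReal ContDiff InnerProductSpace Distributions ComplexConjugate

/-! ### Strongly continuous semigroups and their generators -/

/-- A `C₀`-semigroup of bounded operators on a complex normed space `X`. -/
structure C0Semigroup (X : Type*) [NormedAddCommGroup X] [NormedSpace ℂ X] where
  /-- The bounded operator at time `t ≥ 0`. -/
  op : ℝ≥0 → X →L[ℂ] X
  op_zero : op 0 = ContinuousLinearMap.id ℂ X
  op_add : ∀ s t, op (s + t) = (op s).comp (op t)
  tendsto_op : ∀ x, Tendsto (fun t => op t x) (𝓝[>] 0) (𝓝 x)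

namespace C0Semigroup

variable {X : Type*} [NormedAddCommGroup X] [NormedSpace ℂ X]

/-- `y` is the right derivative at `0` of the orbit of `x`. -/
def HasRightDeriv (U : C0Semigroup X) (x y : X) : Prop :=
  Tendsto (fun t : ℝ≥0 => ((t : ℝ) : ℂ)⁻¹ • (U.op t x - x)) (𝓝[>] 0) (𝓝 y)

theorem HasRightDeriv.unique {U : C0Semigroup X} {x y z : X}
    (h₁ : U.HasRightDeriv x y) (h₂ : U.HasRightDeriv x z) : y = z :=
  tendsto_nhds_unique h₁ h₂

theorem HasRightDeriv.add {U : C0Semigroup X} {x x' y y' : X}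
    (h₁ : U.HasRightDeriv x y) (h₂ : U.HasRightDeriv x' y') :
    U.HasRightDeriv (x + x') (y + y') := by
  refine (Tendsto.add h₁ h₂).congr fun t => ?_
  rw [map_add, ← smul_add]
  congr 1
  abel

theorem HasRightDeriv.smul {U : C0Semigroup X} (c : ℂ) {x y : X}
    (h : U.HasRightDeriv x y) : U.HasRightDeriv (c • x) (c • y) := by
  refine (Tendsto.const_smul h c).congr fun t => ?_
  rw [map_smul, ← smul_sub, smul_comm]

theorem HasRightDeriv.zero (U : C0Semigroup X) : U.HasRightDeriv 0 0 := by
  simp [HasRightDeriv]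

/-- The infinitesimal generator of a `C₀`-semigroup `U`: its domain consists of the `x` for which
`lim_{t → 0+} (U(t) x - x) / t` exists, and its value at such an `x` is this limit. -/
noncomputable def generator (U : C0Semigroup X) : X →ₗ.[ℂ] X where
  domain :=
    { carrier := {x | ∃ y, U.HasRightDeriv x y}
      add_mem' := fun ⟨y, hy⟩ ⟨z, hz⟩ => ⟨y + z, hy.add hz⟩
      zero_mem' := ⟨0, HasRightDeriv.zero U⟩
      smul_mem' := fun c _ ⟨y, hy⟩ => ⟨c • y, hy.smul c⟩ }
  toFun :=
    { toFun := fun x => x.2.choose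
      map_add' := fun x y =>
        (x + y).2.choose_spec.unique (x.2.choose_spec.add y.2.choose_spec)
      map_smul' := fun c x => (c • x).2.choose_spec.unique (x.2.choose_spec.smul c) }

end C0Semigroup

/-! ### The form domain -/

namespace DampedWave

/-- The Lebesgue measure on the open set `Ω ⊆ ℝᵈ`. -/
noncomputable abbrev vol {d : ℕ} (Ω : Opens (EuclideanSpace ℝ (Fin d))) :
    Measure (EuclideanSpace ℝ (Fin d)) :=
  volume.restrict (Ω : Set (EuclideanSpace ℝ (Fin d)))

/-- The complex Hilbert space `L²(Ω)`. -/
abbrev L2 {d : ℕ} (Ω : Opens (EuclideanSpace ℝ (Fin d))) : Type :=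
  Lp ℂ 2 (vol Ω)

/-- The complex Hilbert space `L²(Ω; ℂᵈ)`. -/
abbrev L2Vec {d : ℕ} (Ω : Opens (EuclideanSpace ℝ (Fin d))) : Type :=
  Lp (EuclideanSpace ℂ (Fin d)) 2 (vol Ω)

/-- The coefficients: `a ∈ L^∞(Ω)`, `b ∈ L^∞_loc(Ω)`, and `b` is essentially bounded from below. -/
structure H1 {d : ℕ} (Ω : Opens (EuclideanSpace ℝ (Fin d)))
    (a b : EuclideanSpace ℝ (Fin d) → ℝ) : Prop where
  memLp_a : MemLp a ∞ (vol Ω)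
  meas_b : AEStronglyMeasurable b (vol Ω)
  memLp_b : ∀ K : Set (EuclideanSpace ℝ (Fin d)), IsCompact K → K ⊆ Ω →
    MemLp b ∞ (volume.restrict K)
  bddBelow_b : ∃ c : ℝ, ∀ᵐ x ∂(vol Ω), c ≤ b x

/-- The essential infimum over `Ω`. -/
noncomputable def infOn {d : ℕ} (Ω : Opens (EuclideanSpace ℝ (Fin d)))
    (f : EuclideanSpace ℝ (Fin d) → ℝ) : ℝ :=
  essInf f (vol Ω)

/-- The gradient `(∂₁φ, …, ∂_dφ)` of a complex-valued function. -/
noncomputable def gradient {d : ℕ} (φ : EuclideanSpace ℝ (Fin d) → ℂ)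
    (x : EuclideanSpace ℝ (Fin d)) : EuclideanSpace ℂ (Fin d) :=
  WithLp.toLp 2 fun i => fderiv ℝ φ x (EuclideanSpace.single i 1)

/-- The weight `(b - b_min)^{1/2}`. -/
noncomputable def weight {d : ℕ} (Ω : Opens (EuclideanSpace ℝ (Fin d)))
    (b : EuclideanSpace ℝ (Fin d) → ℝ) (x : EuclideanSpace ℝ (Fin d)) : ℝ :=
  Real.sqrt (b x - infOn Ω b)

/-- The Hilbert space `L²(Ω) × L²(Ω; ℂᵈ) × L²(Ω)`. -/
abbrev Ambient {d : ℕ} (Ω : Opens (EuclideanSpace ℝ (Fin d))) : Type :=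
  WithLp 2 (L2 Ω × WithLp 2 (L2Vec Ω × L2 Ω))

theorem gradient_add {d : ℕ} {φ ψ : EuclideanSpace ℝ (Fin d) → ℂ} (hφ : ContDiff ℝ ∞ φ)
    (hψ : ContDiff ℝ ∞ ψ) (x : EuclideanSpace ℝ (Fin d)) :
    gradient (φ + ψ) x = gradient φ x + gradient ψ x := by
  have h1 := (hφ.differentiable (by simp)).differentiableAt (x := x)
  have h2 := (hψ.differentiable (by simp)).differentiableAt (x := x)
  ext i
  simp [gradient, fderiv_add h1 h2]

theorem gradient_smul {d : ℕ} (c : ℂ) {φ : EuclideanSpace ℝ (Fin d) → ℂ}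
    (hφ : ContDiff ℝ ∞ φ) (x : EuclideanSpace ℝ (Fin d)) :
    gradient (c • φ) x = c • gradient φ x := by
  have h1 := (hφ.differentiable (by simp)).differentiableAt (x := x)
  ext i
  simp [gradient, fderiv_const_smul h1 c]

/-- The triples `(φ, ∇φ, (b - b_min)^{1/2} φ)` with `φ ∈ C₀^∞(Ω)`. Their norm in the ambient
Hilbert space is `‖φ‖_{s₀} = (‖φ‖² + ‖∇φ‖² + ‖(b - b_min)^{1/2} φ‖²)^{1/2}`. -/
noncomputable def testTriples {d : ℕ} (Ω : Opens (EuclideanSpace ℝ (Fin d)))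
    (b : EuclideanSpace ℝ (Fin d) → ℝ) : Submodule ℂ (Ambient Ω) where
  carrier := {p | ∃ φ : 𝓓(Ω, ℂ), p.fst =ᵐ[vol Ω] φ ∧ p.snd.fst =ᵐ[vol Ω] gradient φ ∧
    p.snd.snd =ᵐ[vol Ω] fun x => (weight Ω b x : ℂ) * φ x}
  add_mem' := by
    rintro p q ⟨φ, h1, h2, h3⟩ ⟨ψ, k1, k2, k3⟩
    refine ⟨φ + ψ, ?_, ?_, ?_⟩
    · filter_upwards [Lp.coeFn_add p.fst q.fst, h1, k1] with x hx h k
      rw [WithLp.add_fst, hx, Pi.add_apply, h, k, FunLike.coe_add, Pi.add_apply]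
    · filter_upwards [Lp.coeFn_add p.snd.fst q.snd.fst, h2, k2] with x hx h k
      have := gradient_add φ.contDiff ψ.contDiff x
      simp only [WithLp.add_snd, WithLp.add_fst, hx, Pi.add_apply, h, k, FunLike.coe_add, this]
    · filter_upwards [Lp.coeFn_add p.snd.snd q.snd.snd, h3, k3] with x hx h k
      rw [WithLp.add_snd, WithLp.add_snd, hx, Pi.add_apply, h, k, FunLike.coe_add, Pi.add_apply,
        mul_add]
  zero_mem' := by
    refine ⟨0, ?_, ?_, ?_⟩
    · filter_upwards [Lp.coeFn_zero ℂ 2 (vol Ω)] with x hx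
      rw [WithLp.zero_fst, hx, FunLike.coe_zero]
    · filter_upwards [Lp.coeFn_zero (EuclideanSpace ℂ (Fin d)) 2 (vol Ω)] with x hx
      simp only [WithLp.zero_snd, WithLp.zero_fst, hx]
      ext i
      simp [gradient]
    · filter_upwards [Lp.coeFn_zero ℂ 2 (vol Ω)] with x hx
      rw [WithLp.zero_snd, WithLp.zero_snd, hx, FunLike.coe_zero]
      simp
  smul_mem' := by
    rintro c p ⟨φ, h1, h2, h3⟩
    refine ⟨c • φ, ?_, ?_, ?_⟩
    · filter_upwards [Lp.coeFn_smul c p.fst, h1] with x hx h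
      simp [hx, h]
    · filter_upwards [Lp.coeFn_smul c p.snd.fst, h2] with x hx h
      have := gradient_smul c φ.contDiff x
      simp only [WithLp.smul_snd, WithLp.smul_fst, hx, Pi.smul_apply, h, FunLike.coe_smul, this]
    · filter_upwards [Lp.coeFn_smul c p.snd.snd, h3] with x hx h
      simp [hx, h]
      ring

/-- The form domain `D(s₀)`: the completion of `C₀^∞(Ω)` with respect to `‖·‖_{s₀}`, realised as
the closure of `{(φ, ∇φ, (b - b_min)^{1/2} φ)}` in `L²(Ω) × L²(Ω; ℂᵈ) × L²(Ω)`. It is a Hilbert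
space with the norm `‖·‖_{s₀}`. -/
noncomputable abbrev FormDomain {d : ℕ} (Ω : Opens (EuclideanSpace ℝ (Fin d)))
    (b : EuclideanSpace ℝ (Fin d) → ℝ) : Submodule ℂ (Ambient Ω) :=
  (testTriples Ω b).topologicalClosure

section FormDomain

variable {d : ℕ} {Ω : Opens (EuclideanSpace ℝ (Fin d))} {b : EuclideanSpace ℝ (Fin d) → ℝ}

/-- The embedding of `D(s₀)` into `L²(Ω)`; it is injective, see `toL2_injective`. -/
noncomputable def toL2 (Ω : Opens (EuclideanSpace ℝ (Fin d))) (b : EuclideanSpace ℝ (Fin d) → ℝ) :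
    FormDomain Ω b →ₗ[ℂ] L2 Ω where
  toFun u := u.1.fst
  map_add' _ _ := rfl
  map_smul' _ _ := rfl

/-- The gradient `∇ : D(s₀) → L²(Ω; ℂᵈ)`; it is the weak gradient, see `weak_gradient`. -/
noncomputable def grad (Ω : Opens (EuclideanSpace ℝ (Fin d))) (b : EuclideanSpace ℝ (Fin d) → ℝ) :
    FormDomain Ω b →ₗ[ℂ] L2Vec Ω where
  toFun u := u.1.snd.fst
  map_add' _ _ := rfl
  map_smul' _ _ := rfl

/-- The sesquilinear form `s₀(φ, ψ) = (∇φ, ∇ψ) + (φ, bψ)` on `D(s₀)`, antilinear in `φ`. -/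
noncomputable def sForm (φ ψ : FormDomain Ω b) : ℂ :=
  ⟪grad Ω b φ, grad Ω b ψ⟫_ℂ +
    ∫ x in (Ω : Set (EuclideanSpace ℝ (Fin d))),
      conj (toL2 Ω b φ x) * ((b x : ℂ) * toL2 Ω b ψ x)

theorem memLp_of_continuous {F : Type*} [NormedAddCommGroup F]
    {f : EuclideanSpace ℝ (Fin d) → F} (hf : Continuous f) (hc : HasCompactSupport f) :
    MemLp f 2 (vol Ω) :=
  (hf.memLp_of_hasCompactSupport hc).restrict _

theorem weight_ae (u : FormDomain Ω b) :
    (u.1.snd.snd : EuclideanSpace ℝ (Fin d) → ℂ) =ᵐ[vol Ω]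
      fun x => (weight Ω b x : ℂ) * toL2 Ω b u x := by
  have hu : (u : Ambient Ω) ∈ closure (testTriples Ω b : Set (Ambient Ω)) := u.2
  obtain ⟨p, hp, hlim⟩ := mem_closure_iff_seq_limit.1 hu
  have l1 : Tendsto (fun n => (p n).fst) atTop (𝓝 u.1.fst) :=
    ((WithLp.continuous_fst (p := 2) (α := L2 Ω)
      (β := WithLp 2 (L2Vec Ω × L2 Ω))).tendsto _).comp hlim
  have l2 : Tendsto (fun n => (p n).snd.snd) atTop (𝓝 u.1.snd.snd) :=
    ((WithLp.continuous_snd (p := 2) (α := L2Vec Ω) (β := L2 Ω)).tendsto _).comp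
      (((WithLp.continuous_snd (p := 2) (α := L2 Ω)
        (β := WithLp 2 (L2Vec Ω × L2 Ω))).tendsto _).comp hlim)
  obtain ⟨ns, hns, h1⟩ := (tendstoInMeasure_of_tendsto_Lp l1).exists_seq_tendsto_ae
  obtain ⟨ms, hms, h2⟩ :=
    (tendstoInMeasure_of_tendsto_Lp (l2.comp hns.tendsto_atTop)).exists_seq_tendsto_ae
  have key : ∀ n, ∀ᵐ x ∂(vol Ω), (p n).snd.snd x = (weight Ω b x : ℂ) * (p n).fst x := by
    intro n
    obtain ⟨φ, k1, _, k3⟩ := hp n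
    filter_upwards [k1, k3] with x e1 e3
    rw [e3, e1]
  filter_upwards [h1, h2, ae_all_iff.2 key] with x e1 e2 e
  have e1' := (e1.comp hms.tendsto_atTop).const_mul (weight Ω b x : ℂ)
  refine tendsto_nhds_unique e2 (e1'.congr fun n => ?_)
  exact (e _).symm

theorem inner_single (i : Fin d) (z : ℂ) (w : EuclideanSpace ℂ (Fin d)) :
    ⟪EuclideanSpace.single i z, w⟫_ℂ = conj z * w i := by
  exact EuclideanSpace.inner_single_left i z w

theorem weak_gradient (u : FormDomain Ω b) (η : 𝓓(Ω, ℝ)) (i : Fin d) :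
    ∫ x in (Ω : Set (EuclideanSpace ℝ (Fin d))), η x • grad Ω b u x i =
      -∫ x in (Ω : Set (EuclideanSpace ℝ (Fin d))),
        fderiv ℝ η x (EuclideanSpace.single i 1) • toL2 Ω b u x := by
  have hη : ContDiff ℝ ∞ η := η.contDiff
  have hηs : HasCompactSupport η := η.hasCompactSupport
  have hd : Continuous fun x => fderiv ℝ η x (EuclideanSpace.single i 1) :=
    (hη.continuous_fderiv (by simp)).clm_apply continuous_const
  have hds : HasCompactSupport fun x => fderiv ℝ η x (EuclideanSpace.single i 1) :=
    hηs.fderiv_apply (𝕜 := ℝ) _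
  have hF : MemLp (fun x => (EuclideanSpace.single i (η x : ℂ) : EuclideanSpace ℂ (Fin d))) 2
      (vol Ω) := by
    refine memLp_of_continuous ?_ (hηs.comp_left
      (g := fun t : ℝ => (EuclideanSpace.single i (t : ℂ) : EuclideanSpace ℂ (Fin d))) ?_)
    · have : (fun x => (EuclideanSpace.single i (η x : ℂ) : EuclideanSpace ℂ (Fin d))) =
          fun x => (η x : ℂ) • (EuclideanSpace.single i (1 : ℂ) : EuclideanSpace ℂ (Fin d)) := by
        ext x j
        by_cases hj : j = i <;> simp [hj]
      rw [this]
      exact (Complex.continuous_ofReal.comp η.continuous).smul continuous_const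
    · ext j
      simp
  have hG : MemLp (fun x => (fderiv ℝ η x (EuclideanSpace.single i 1) : ℂ)) 2 (vol Ω) :=
    memLp_of_continuous (Complex.continuous_ofReal.comp hd)
      (hds.comp_left (g := fun t : ℝ => (t : ℂ)) (by simp))
  have e1 : ∀ f : L2Vec Ω, ⟪hF.toLp _, f⟫_ℂ =
      ∫ x in (Ω : Set (EuclideanSpace ℝ (Fin d))), η x • f x i := by
    intro f
    rw [MeasureTheory.L2.inner_def]
    refine integral_congr_ae ?_
    filter_upwards [hF.coeFn_toLp] with x hx
    rw [hx, inner_single, Complex.conj_ofReal, Complex.real_smul]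
  have e2 : ∀ f : L2 Ω, ⟪hG.toLp _, f⟫_ℂ =
      ∫ x in (Ω : Set (EuclideanSpace ℝ (Fin d))),
        fderiv ℝ η x (EuclideanSpace.single i 1) • f x := by
    intro f
    rw [MeasureTheory.L2.inner_def]
    refine integral_congr_ae ?_
    filter_upwards [hG.coeFn_toLp] with x hx
    rw [hx, RCLike.inner_apply, Complex.conj_ofReal, Complex.real_smul, mul_comm]
  have key : ∀ p ∈ closure (testTriples Ω b : Set (Ambient Ω)),
      ⟪hF.toLp _, p.snd.fst⟫_ℂ = -⟪hG.toLp _, p.fst⟫_ℂ := by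
    intro p hp
    refine closure_minimal (t := {p : Ambient Ω |
      ⟪hF.toLp _, p.snd.fst⟫_ℂ = -⟪hG.toLp _, p.fst⟫_ℂ}) ?_ ?_ hp
    · rintro p ⟨φ, h1, h2, -⟩
      have hφ : ContDiff ℝ ∞ φ := φ.contDiff
      have hdφ : Continuous fun x => fderiv ℝ φ x (EuclideanSpace.single i 1) :=
        (hφ.continuous_fderiv (by simp)).clm_apply continuous_const
      rw [Set.mem_ofPred_eq, e1, e2]
      have i1 : ∫ x in (Ω : Set (EuclideanSpace ℝ (Fin d))), η x • p.snd.fst x i =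
          ∫ x, η x • fderiv ℝ φ x (EuclideanSpace.single i 1) := by
        rw [integral_congr_ae (g := fun x => η x • fderiv ℝ φ x (EuclideanSpace.single i 1))]
        · refine setIntegral_eq_integral_of_forall_compl_eq_zero fun x hx => ?_
          rw [image_eq_zero_of_notMem_tsupport fun h => hx (η.tsupport_subset h), zero_smul]
        · filter_upwards [h2] with x hx
          simp [hx, gradient]
      have i2 : ∫ x in (Ω : Set (EuclideanSpace ℝ (Fin d))),
            fderiv ℝ η x (EuclideanSpace.single i 1) • p.fst x =
          ∫ x, fderiv ℝ η x (EuclideanSpace.single i 1) • φ x := by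
        rw [integral_congr_ae
          (g := fun x => fderiv ℝ η x (EuclideanSpace.single i 1) • φ x)]
        · refine setIntegral_eq_integral_of_forall_compl_eq_zero fun x hx => ?_
          rw [image_eq_zero_of_notMem_tsupport fun h => hx (φ.tsupport_subset h), smul_zero]
        · filter_upwards [h1] with x hx
          rw [hx]
      rw [i1, i2]
      refine integral_smul_fderiv_eq_neg_fderiv_smul_of_integrable ?_ ?_ ?_ ?_ ?_
      · exact (hd.smul φ.continuous).integrable_of_hasCompactSupport hds.smul_right
      · exact (η.continuous.smul hdφ).integrable_of_hasCompactSupport hηs.smul_right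
      · exact (η.continuous.smul φ.continuous).integrable_of_hasCompactSupport hηs.smul_right
      · exact fun x _ => (hη.differentiable (by simp)).differentiableAt
      · exact fun x _ => (hφ.differentiable (by simp)).differentiableAt
    · refine isClosed_eq ?_ ?_
      · exact continuous_const.inner ((WithLp.continuous_fst (p := 2) (α := L2Vec Ω)
          (β := L2 Ω)).comp (WithLp.continuous_snd (p := 2) (α := L2 Ω)
            (β := WithLp 2 (L2Vec Ω × L2 Ω))))
      · exact (continuous_const.inner (WithLp.continuous_fst (p := 2) (α := L2 Ω)
          (β := WithLp 2 (L2Vec Ω × L2 Ω)))).neg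
  have := key u.1 u.2
  rw [e1, e2] at this
  exact this

theorem ae_eq_zero_of_test {f : EuclideanSpace ℝ (Fin d) → ℂ} (hf : MemLp f 2 (vol Ω))
    (h : ∀ η : 𝓓(Ω, ℝ), ∫ x in (Ω : Set (EuclideanSpace ℝ (Fin d))), η x • f x = 0) :
    f =ᵐ[vol Ω] 0 := by
  have hloc : LocallyIntegrableOn f (Ω : Set (EuclideanSpace ℝ (Fin d))) volume :=
    locallyIntegrableOn_of_locallyIntegrable_restrict (hf.locallyIntegrable (by norm_num))
  refine (ae_restrict_iff' Ω.isOpen.measurableSet).2 ?_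
  refine Ω.isOpen.ae_eq_zero_of_integral_contDiff_smul_eq_zero hloc fun g hg hgs hgΩ => ?_
  rw [← h ⟨g, hg, hgs, hgΩ⟩]
  refine (setIntegral_eq_integral_of_forall_compl_eq_zero fun x hx => ?_).symm
  have : g x = 0 := image_eq_zero_of_notMem_tsupport fun h => hx (hgΩ h)
  simp [this]

theorem toL2_injective : Function.Injective (toL2 Ω b) := by
  rw [injective_iff_map_eq_zero]
  intro u hu
  have h0 : (toL2 Ω b u : EuclideanSpace ℝ (Fin d) → ℂ) =ᵐ[vol Ω] 0 := by
    rw [hu]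
    exact Lp.coeFn_zero _ _ _
  have hw : u.1.snd.snd = 0 := by
    refine Lp.ext ?_
    filter_upwards [weight_ae u, h0, Lp.coeFn_zero ℂ 2 (vol Ω)] with x h1 h2 h3
    rw [h1, h2, h3]
    simp
  have hg : u.1.snd.fst = 0 := by
    have hi : ∀ i : Fin d, (fun x => grad Ω b u x i) =ᵐ[vol Ω] 0 := by
      intro i
      refine ae_eq_zero_of_test ?_ fun η => ?_
      · exact (EuclideanSpace.proj (𝕜 := ℂ) i).comp_memLp' (Lp.memLp (grad Ω b u))
      · rw [weak_gradient, neg_eq_zero]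
        refine integral_eq_zero_of_ae ?_
        filter_upwards [h0] with x hx
        simp [hx]
    refine Lp.ext ?_
    filter_upwards [ae_all_iff.2 hi, Lp.coeFn_zero (EuclideanSpace ℂ (Fin d)) 2 (vol Ω)]
      with x h1 h2
    rw [h2]
    ext i
    exact h1 i
  have hf : u.1.fst = 0 := hu
  refine Subtype.ext (WithLp.ofLp_injective 2 (Prod.ext hf ?_))
  exact WithLp.ofLp_injective 2 (Prod.ext hg hw)

end FormDomain

/-! ### The operators -/

section Operators

variable {d : ℕ} {Ω : Opens (EuclideanSpace ℝ (Fin d))} {a b : EuclideanSpace ℝ (Fin d) → ℝ}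

theorem H1.infOn_le (h : H1 Ω a b) : ∀ᵐ x ∂(vol Ω), infOn Ω b ≤ b x := by
  obtain ⟨c, hc⟩ := h.bddBelow_b
  exact ae_essInf_le ⟨c, by simpa using hc⟩

theorem H1.integrable_sForm (h : H1 Ω a b) (φ ψ : FormDomain Ω b) :
    Integrable (fun x => conj (toL2 Ω b φ x) * ((b x : ℂ) * toL2 Ω b ψ x)) (vol Ω) := by
  have i1 := MeasureTheory.L2.integrable_inner (𝕜 := ℂ) φ.1.snd.snd ψ.1.snd.snd
  have i2 := MeasureTheory.L2.integrable_inner (𝕜 := ℂ) (toL2 Ω b φ) (toL2 Ω b ψ)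
  refine (i1.add (i2.const_mul (infOn Ω b : ℂ))).congr ?_
  filter_upwards [weight_ae φ, weight_ae ψ, h.infOn_le] with x h1 h2 h3
  have : (b x : ℂ) = (weight Ω b x : ℂ) * weight Ω b x + infOn Ω b := by
    rw [weight, ← Complex.ofReal_mul, Real.mul_self_sqrt (by linarith)]
    simp
  simp only [Pi.add_apply, RCLike.inner_apply, h1, h2, this, map_mul, Complex.conj_ofReal]
  ring

theorem H1.sForm_add (h : H1 Ω a b) (φ ψ χ : FormDomain Ω b) :
    sForm φ (ψ + χ) = sForm φ ψ + sForm φ χ := by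
  have : ∫ x in (Ω : Set (EuclideanSpace ℝ (Fin d))),
      conj (toL2 Ω b φ x) * ((b x : ℂ) * toL2 Ω b (ψ + χ) x) =
      (∫ x in (Ω : Set (EuclideanSpace ℝ (Fin d))),
        conj (toL2 Ω b φ x) * ((b x : ℂ) * toL2 Ω b ψ x)) +
      ∫ x in (Ω : Set (EuclideanSpace ℝ (Fin d))),
        conj (toL2 Ω b φ x) * ((b x : ℂ) * toL2 Ω b χ x) := by
    rw [← integral_add (h.integrable_sForm φ ψ) (h.integrable_sForm φ χ), map_add]
    refine integral_congr_ae ?_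
    filter_upwards [Lp.coeFn_add (toL2 Ω b ψ) (toL2 Ω b χ)] with x hx
    rw [hx, Pi.add_apply]
    ring
  rw [sForm, sForm, sForm, this, map_add, inner_add_right]
  ring

theorem sForm_smul (c : ℂ) (φ ψ : FormDomain Ω b) :
    sForm φ (c • ψ) = c * sForm φ ψ := by
  have : ∫ x in (Ω : Set (EuclideanSpace ℝ (Fin d))),
      conj (toL2 Ω b φ x) * ((b x : ℂ) * toL2 Ω b (c • ψ) x) =
      c * ∫ x in (Ω : Set (EuclideanSpace ℝ (Fin d))),
        conj (toL2 Ω b φ x) * ((b x : ℂ) * toL2 Ω b ψ x) := by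
    rw [← integral_const_mul, map_smul]
    refine integral_congr_ae ?_
    filter_upwards [Lp.coeFn_smul c (toL2 Ω b ψ)] with x hx
    rw [hx, Pi.smul_apply, smul_eq_mul]
    ring
  rw [sForm, sForm, this, map_smul, inner_smul_right]
  ring

theorem sqrt_le_one_add_norm (t : ℝ) : Real.sqrt t ≤ 1 + ‖t‖ := by
  have h0 := norm_nonneg t
  have h1 := Real.le_norm_self t
  rw [Real.sqrt_le_left (by linarith)]
  nlinarith

theorem H1.memLp_weight (h : H1 Ω a b) {K : Set (EuclideanSpace ℝ (Fin d))} (hK : IsCompact K)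
    (hKΩ : K ⊆ Ω) : MemLp (fun x => (weight Ω b x : ℂ)) ∞ (volume.restrict K) := by
  have : IsFiniteMeasure (volume.restrict K) := isFiniteMeasure_restrict.2 hK.measure_lt_top.ne
  have hb := h.memLp_b K hK hKΩ
  have hsub : MemLp (fun x => b x - infOn Ω b) ∞ (volume.restrict K) :=
    MemLp.sub hb (memLp_const (infOn Ω b))
  have hs : MemLp (fun x => 1 + ‖b x - infOn Ω b‖) ∞ (volume.restrict K) :=
    MemLp.add (f := fun _ => (1 : ℝ)) (memLp_const (1 : ℝ)) hsub.norm
  refine MemLp.of_le hs ?_ (ae_of_all _ fun x => ?_)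
  · have hm : AEStronglyMeasurable (fun x => b x - infOn Ω b) (volume.restrict K) :=
      hb.1.sub aestronglyMeasurable_const
    have hm' : AEStronglyMeasurable (fun x => Real.sqrt (b x - infOn Ω b)) (volume.restrict K) :=
      Real.continuous_sqrt.comp_aestronglyMeasurable hm
    exact Complex.continuous_ofReal.comp_aestronglyMeasurable hm'
  · rw [Complex.norm_real, weight, Real.norm_of_nonneg (Real.sqrt_nonneg _)]
    exact (sqrt_le_one_add_norm _).trans (Real.le_norm_self _)

theorem H1.memLp_weight_mul (h : H1 Ω a b) (η : 𝓓(Ω, ℂ)) :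
    MemLp (fun x => (weight Ω b x : ℂ) * η x) 2 (vol Ω) := by
  have hK : IsCompact (tsupport η) := η.hasCompactSupport
  have hη : MemLp η 2 (volume.restrict (tsupport η)) :=
    (η.continuous.memLp_of_hasCompactSupport η.hasCompactSupport).restrict _
  have hm : MemLp (fun x => (weight Ω b x : ℂ) * η x) 2 (volume.restrict (tsupport η)) :=
    MemLp.mul' (p := ∞) (q := 2) hη (h.memLp_weight hK η.tsupport_subset)
  rw [← memLp_indicator_iff_restrict (isClosed_tsupport η).measurableSet] at hm
  have he : (tsupport η).indicator (fun x => (weight Ω b x : ℂ) * η x) =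
      fun x => (weight Ω b x : ℂ) * η x := by
    refine Set.indicator_eq_self.2 fun x hx => ?_
    refine subset_tsupport _ fun h0 => hx ?_
    simp [h0]
  rw [he] at hm
  exact hm.restrict _

theorem memLp_gradient (η : 𝓓(Ω, ℂ)) : MemLp (gradient η) 2 (vol Ω) := by
  have hη : ContDiff ℝ ∞ η := η.contDiff
  refine memLp_of_continuous ?_ ?_
  · refine (PiLp.continuous_toLp 2 _).comp (continuous_pi fun i => ?_)
    exact (hη.continuous_fderiv (by simp)).clm_apply continuous_const
  · refine HasCompactSupport.intro η.hasCompactSupport.isCompact fun x hx => ?_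
    have : fderiv ℝ η x = 0 :=
      image_eq_zero_of_notMem_tsupport fun hx' => hx (tsupport_fderiv_subset ℝ hx')
    ext i
    simp [gradient, this]

/-- Every test function lies in `D(s₀)`. -/
theorem H1.exists_test (h : H1 Ω a b) (η : 𝓓(Ω, ℂ)) :
    ∃ u : FormDomain Ω b, toL2 Ω b u =ᵐ[vol Ω] η := by
  have h1 : MemLp η 2 (vol Ω) := memLp_of_continuous η.continuous η.hasCompactSupport
  have h2 := memLp_gradient η
  have h3 := h.memLp_weight_mul η
  let p : Ambient Ω := WithLp.toLp 2 (h1.toLp _, WithLp.toLp 2 (h2.toLp _, h3.toLp _))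
  have hp : p ∈ testTriples Ω b := ⟨η, h1.coeFn_toLp, h2.coeFn_toLp, h3.coeFn_toLp⟩
  exact ⟨⟨p, subset_closure hp⟩, h1.coeFn_toLp⟩

/-- `D(s₀)` is dense in `L²(Ω)`. -/
theorem H1.eq_of_inner (h : H1 Ω a b) {f g : L2 Ω}
    (hfg : ∀ φ : FormDomain Ω b, ⟪toL2 Ω b φ, f⟫_ℂ = ⟪toL2 Ω b φ, g⟫_ℂ) : f = g := by
  rw [← sub_eq_zero]
  refine Lp.ext (EventuallyEq.trans ?_ (Lp.coeFn_zero ℂ 2 (vol Ω)).symm)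
  refine ae_eq_zero_of_test (Lp.memLp _) fun η => ?_
  obtain ⟨u, hu⟩ := h.exists_test ⟨fun x => (η x : ℂ),
    Complex.ofRealCLM.contDiff.comp η.contDiff,
    η.hasCompactSupport.comp_left (g := fun t : ℝ => (t : ℂ)) (by simp),
    (tsupport_comp_subset (g := fun t : ℝ => (t : ℂ)) (by simp) η).trans η.tsupport_subset⟩
  have h0 : ⟪toL2 Ω b u, f - g⟫_ℂ = 0 := by
    rw [inner_sub_right, hfg, sub_self]
  rw [← h0, MeasureTheory.L2.inner_def]
  refine integral_congr_ae ?_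
  filter_upwards [hu] with x hx
  rw [hx, RCLike.inner_apply, Complex.real_smul, mul_comm]
  change _ = _ * conj (η x : ℂ)
  rw [Complex.conj_ofReal]

/-- `f = S₀ψ`, that is, `s₀(φ, ψ) = (φ, f)` for all `φ ∈ D(s₀)`. -/
def IsS0 (ψ : FormDomain Ω b) (f : L2 Ω) : Prop :=
  ∀ φ : FormDomain Ω b, sForm φ ψ = ⟪toL2 Ω b φ, f⟫_ℂ

theorem H1.isS0_add (h : H1 Ω a b) {ψ χ : FormDomain Ω b} {f g : L2 Ω} (hf : IsS0 ψ f)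
    (hg : IsS0 χ g) : IsS0 (ψ + χ) (f + g) := fun φ => by
  rw [h.sForm_add, hf, hg, inner_add_right]

theorem isS0_smul (c : ℂ) {ψ : FormDomain Ω b} {f : L2 Ω} (hf : IsS0 ψ f) :
    IsS0 (c • ψ) (c • f) := fun φ => by
  rw [sForm_smul, hf, inner_smul_right]

theorem isS0_zero : IsS0 (0 : FormDomain Ω b) 0 := by
  intro φ
  have := sForm_smul 0 φ (0 : FormDomain Ω b)
  rw [zero_smul, zero_mul] at this
  rw [this, inner_zero_right]

/-- The self-adjoint operator `S₀ = -Δ + b` with Dirichlet boundary conditions, that is, the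
operator associated with the form `s₀`: a function `ψ ∈ D(s₀)` is in `D(S₀)` if and only if there
is an `f ∈ L²(Ω)` with `s₀(φ, ψ) = (φ, f)` for all `φ ∈ D(s₀)`, and then `S₀ψ = f`. It is regarded
here as a partially defined operator from `D(s₀)` to `L²(Ω)`. -/
noncomputable def opS0 (h : H1 Ω a b) : FormDomain Ω b →ₗ.[ℂ] L2 Ω where
  domain :=
    { carrier := {ψ | ∃ f, IsS0 ψ f}
      add_mem' := fun ⟨f, hf⟩ ⟨g, hg⟩ => ⟨f + g, h.isS0_add hf hg⟩
      zero_mem' := ⟨0, isS0_zero⟩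
      smul_mem' := fun c _ ⟨f, hf⟩ => ⟨c • f, isS0_smul c hf⟩ }
  toFun :=
    { toFun := fun ψ => ψ.2.choose
      map_add' := fun ψ χ => h.eq_of_inner fun φ =>
        ((ψ + χ).2.choose_spec φ).symm.trans
          (h.isS0_add ψ.2.choose_spec χ.2.choose_spec φ)
      map_smul' := fun c ψ => h.eq_of_inner fun φ =>
        ((c • ψ).2.choose_spec φ).symm.trans (isS0_smul c ψ.2.choose_spec φ) }

theorem H1.memLp_mul (h : H1 Ω a b) (ψ : L2 Ω) :
    MemLp (fun x => (a x : ℂ) * ψ x) 2 (vol Ω) :=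
  MemLp.mul' (p := ∞) (q := 2) (Lp.memLp ψ) h.memLp_a.ofReal

/-- Multiplication by `a ∈ L^∞(Ω)` on `L²(Ω)`. -/
noncomputable def mulA (h : H1 Ω a b) : L2 Ω →ₗ[ℂ] L2 Ω where
  toFun ψ := (h.memLp_mul ψ).toLp _
  map_add' ψ χ := by
    rw [← MemLp.toLp_add]
    refine MemLp.toLp_congr _ _ ?_
    filter_upwards [Lp.coeFn_add ψ χ] with x hx
    rw [hx, Pi.add_apply, Pi.add_apply, mul_add]
  map_smul' c ψ := by
    rw [RingHom.id_apply, ← MemLp.toLp_const_smul]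
    refine MemLp.toLp_congr _ _ ?_
    filter_upwards [Lp.coeFn_smul c ψ] with x hx
    rw [hx, Pi.smul_apply, Pi.smul_apply, smul_eq_mul, smul_eq_mul, mul_left_comm]

/-- The Hilbert space `𝓗 = D(s₀) × L²(Ω)` with the norm
`‖{ψ₁, ψ₂}‖² = ‖ψ₁‖²_{s₀} + ‖ψ₂‖²`. -/
abbrev StateSpace {d : ℕ} (Ω : Opens (EuclideanSpace ℝ (Fin d)))
    (b : EuclideanSpace ℝ (Fin d) → ℝ) : Type :=
  WithLp 2 (FormDomain Ω b × L2 Ω)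

/-- The inverse of the embedding of `D(s₀)` into `L²(Ω)`. -/
noncomputable def ofL2 (Ω : Opens (EuclideanSpace ℝ (Fin d)))
    (b : EuclideanSpace ℝ (Fin d) → ℝ) : LinearMap.range (toL2 Ω b) →ₗ[ℂ] FormDomain Ω b :=
  (LinearEquiv.ofInjective (toL2 Ω b) toL2_injective).symm

/-- The domain `D(A_α) = D(S₀) × D(s₀)`, a subspace of `𝓗`. -/
noncomputable def waveDomain (h : H1 Ω a b) : Submodule ℂ (StateSpace Ω b) where
  carrier := {Ψ | Ψ.fst ∈ (opS0 h).domain ∧ Ψ.snd ∈ LinearMap.range (toL2 Ω b)}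
  add_mem' := fun hΨ hΘ => ⟨add_mem hΨ.1 hΘ.1, add_mem hΨ.2 hΘ.2⟩
  zero_mem' := ⟨zero_mem _, zero_mem _⟩
  smul_mem' := fun c _ hΨ => ⟨Submodule.smul_mem _ c hΨ.1, Submodule.smul_mem _ c hΨ.2⟩

/-- `{ψ₁, ψ₂} ↦ ψ₁` from `D(A_α)` to `D(S₀)`. -/
noncomputable def comp₁ (h : H1 Ω a b) : waveDomain h →ₗ[ℂ] (opS0 h).domain where
  toFun Ψ := ⟨Ψ.1.fst, Ψ.2.1⟩
  map_add' _ _ := rfl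
  map_smul' _ _ := rfl

/-- `{ψ₁, ψ₂} ↦ ψ₂` from `D(A_α)` to `D(s₀)`. -/
noncomputable def comp₂ (h : H1 Ω a b) : waveDomain h →ₗ[ℂ] FormDomain Ω b :=
  (ofL2 Ω b).comp
    (LinearMap.codRestrict (LinearMap.range (toL2 Ω b))
      ((WithLp.sndₗ 2 ℂ (FormDomain Ω b) (L2 Ω)).comp (waveDomain h).subtype) fun Ψ => Ψ.2.2)

/-- The damped wave operator `A_α {ψ₁, ψ₂} = {ψ₂, -S₀ψ₁ - αaψ₂}` on `𝓗`, with the domain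
`D(A_α) = D(S₀) × D(s₀)`. -/
noncomputable def dampedWaveOp (h : H1 Ω a b) (α : ℝ) : StateSpace Ω b →ₗ.[ℂ] StateSpace Ω b where
  domain := waveDomain h
  toFun :=
    { toFun := fun Ψ =>
        WithLp.toLp 2 (comp₂ h Ψ, -opS0 h (comp₁ h Ψ) - (α : ℂ) • mulA h Ψ.1.snd)
      map_add' := fun Ψ Θ => by
        refine WithLp.ofLp_injective 2 (Prod.ext (map_add (comp₂ h) Ψ Θ) ?_)
        have h2 : opS0 h (comp₁ h (Ψ + Θ)) = opS0 h (comp₁ h Ψ) + opS0 h (comp₁ h Θ) := by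
          rw [map_add, LinearPMap.map_add]
        have h3 : mulA h (Ψ + Θ).1.snd = mulA h Ψ.1.snd + mulA h Θ.1.snd :=
          map_add (mulA h) Ψ.1.snd Θ.1.snd
        change -opS0 h _ - (α : ℂ) • mulA h _ = (-opS0 h _ - (α : ℂ) • mulA h _) +
          (-opS0 h _ - (α : ℂ) • mulA h _)
        rw [h2, h3, smul_add]
        abel
      map_smul' := fun c Ψ => by
        refine WithLp.ofLp_injective 2 (Prod.ext (map_smul (comp₂ h) c Ψ) ?_)
        have h2 : opS0 h (comp₁ h (c • Ψ)) = c • opS0 h (comp₁ h Ψ) := by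
          rw [map_smul, LinearPMap.map_smul]
        have h3 : mulA h (c • Ψ).1.snd = c • mulA h Ψ.1.snd :=
          map_smul (mulA h) c Ψ.1.snd
        change -opS0 h _ - (α : ℂ) • mulA h _ = c • (-opS0 h _ - (α : ℂ) • mulA h _)
        rw [h2, h3, smul_sub, smul_neg, smul_comm c (α : ℂ)] }

end Operators

end DampedWave

/-!
The operator `A_α` is quasi-dissipative on the Hilbert space `𝓗`, and `l - A_α` is surjective for
large real `l`, so that the Lumer–Phillips theorem applies.

*Dissipativity.* The norm of `D(s₀)` satisfies `⟪φ, ψ⟫ = s₀(φ, ψ) + (1 - b_min) (φ, ψ)`. Hence the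
terms with `S₀ψ₁` cancel in the real part of `(Ψ, A_α Ψ)`, and
`Re (Ψ, A_α Ψ) = (1 - b_min) Re (ψ₂, ψ₁) - α (ψ₂, aψ₂) ≤ w ‖Ψ‖²` with
`w = 1 + α|a_min| + |b_min|`, which is `DampedWave.re_inner_dampedWaveOp_le`.

*Range.* For `l > w` the system `(l - A_α){ψ₁, ψ₂} = {f₁, f₂}` reduces, by elimination of `ψ₂`, to
`S₀ψ₁ + (l² + lαa)ψ₁ = f₂ + (l + αa)f₁`. Its form is
`⟪φ, ψ⟫ + (φ, (l² + lαa + b_min - 1)ψ)`, where the second summand is nonnegative for `φ = ψ`, and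
the Lax–Milgram argument solves it (`DampedWave.exists_isS0`).

*Generation.* In a Hilbert space these two properties make the domain dense and give
`‖(l - A)⁻¹‖ ≤ 1 / (l - w)`. The Hille–Yosida theorem is proved with the Yosida approximations
`A_l = l A (l - A)⁻¹`: they are bounded, commute, converge strongly to `A` on its domain, and
satisfy `‖e^{tA_l}‖ ≤ e^{twl/(l - w)}`. Therefore `e^{tA_l}` converges strongly to a semigroup
bounded by `e^{wt}`, which is stronger than the bound with `2w`. Its generator
extends `A`, and equals `A` since `l - A` is surjective and `l` minus the generator is injective
(`IsResolventFamily.exists_semigroup`).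
-/

/-! ### Exponentials of bounded operators -/

namespace ContinuousLinearMap

variable {X : Type*} [NormedAddCommGroup X] [NormedSpace ℂ X]

theorem norm_pow_le_pow_norm (B : X →L[ℂ] X) (n : ℕ) : ‖B ^ n‖ ≤ ‖B‖ ^ n := by
  induction n with
  | zero => exact pow_zero B ▸ pow_zero ‖B‖ ▸ norm_id_le (𝕜 := ℂ) (E := X)
  | succ n ih =>
    rw [pow_succ, pow_succ]
    exact (norm_mul_le _ _).trans (by gcongr)

variable [CompleteSpace X]

theorem norm_exp_le (B : X →L[ℂ] X) : ‖NormedSpace.exp B‖ ≤ Real.exp ‖B‖ := by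
  have h1 := NormedSpace.exp_series_hasSum_exp' (𝕂 := ℂ) B
  have h2 := NormedSpace.exp_series_hasSum_exp' (𝕂 := ℝ) ‖B‖
  rw [← Real.exp_eq_exp_ℝ] at h2
  refine h1.norm_le_of_bounded h2 fun n => ?_
  rw [norm_smul, smul_eq_mul]
  gcongr
  · simp
  · exact norm_pow_le_pow_norm B n

/-- Splitting off the scalar part gives a bound that is better than `e^{‖B‖ + |c|}`; this is what
keeps the exponentials of the Yosida approximations bounded. -/
theorem norm_exp_sub_smul_one_le (B : X →L[ℂ] X) (c : ℝ) :
    ‖NormedSpace.exp (B - (c : ℂ) • (1 : X →L[ℂ] X))‖ ≤ Real.exp (‖B‖ - c) := by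
  have hc : Commute B (-((c : ℂ) • (1 : X →L[ℂ] X))) :=
    ((Commute.one_right B).smul_right _).neg_right
  -- The addition formula for `exp` is stated for algebras over `ℚ`.
  let _ : NormedAlgebra ℚ (X →L[ℂ] X) := NormedAlgebra.restrictScalars ℚ ℂ (X →L[ℂ] X)
  have he : NormedSpace.exp (-((c : ℂ) • (1 : X →L[ℂ] X))) =
      ((Real.exp (-c) : ℝ) : ℂ) • (1 : X →L[ℂ] X) := by
    have := NormedSpace.algebraMap_exp_comm (𝕂 := ℂ) (𝔸 := X →L[ℂ] X) (-c : ℂ)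
    rw [Algebra.algebraMap_eq_smul_one, Algebra.algebraMap_eq_smul_one,
      ← Complex.exp_eq_exp_ℂ] at this
    rw [← neg_smul, ← this]
    simp
  rw [sub_eq_add_neg, NormedSpace.exp_add_of_commute hc, he, mul_smul_comm, mul_one, norm_smul,
    Complex.norm_real, Real.norm_of_nonneg (Real.exp_pos _).le, sub_eq_add_neg, add_comm,
    Real.exp_add]
  gcongr
  exact norm_exp_le B

theorem hasDerivAt_exp_smul (B : X →L[ℂ] X) (t : ℝ) :
    HasDerivAt (fun s : ℝ => NormedSpace.exp ((s : ℂ) • B))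
      (NormedSpace.exp ((t : ℂ) • B) * B) t := by
  simpa [Function.comp_def] using
    (hasDerivAt_exp_smul_const (𝕂 := ℂ) B (t : ℂ)).scomp t Complex.ofRealCLM.hasDerivAt

theorem hasDerivAt_exp_smul_apply (B : X →L[ℂ] X) (x : X) (t : ℝ) :
    HasDerivAt (fun s : ℝ => NormedSpace.exp ((s : ℂ) • B) x)
      (NormedSpace.exp ((t : ℂ) • B) (B x)) t :=
  ((apply ℂ X x).restrictScalars ℝ).hasFDerivAt.comp_hasDerivAt t (hasDerivAt_exp_smul B t)

theorem norm_exp_smul_apply_sub_le {B : X →L[ℂ] X} {K t : ℝ} (ht : 0 ≤ t)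
    (hB : ∀ s ∈ Set.Icc 0 t, ‖NormedSpace.exp ((s : ℂ) • B)‖ ≤ K) (x : X) :
    ‖NormedSpace.exp ((t : ℂ) • B) x - x‖ ≤ K * ‖B x‖ * t := by
  have := norm_image_sub_le_of_norm_deriv_le_segment' (a := 0) (b := t)
    (fun s _ => (hasDerivAt_exp_smul_apply B x s).hasDerivWithinAt) (C := K * ‖B x‖)
    (fun s hs => (le_opNorm _ _).trans
      (mul_le_mul_of_nonneg_right (hB s ⟨hs.1, hs.2.le⟩) (norm_nonneg _)))
    t ⟨ht, le_rfl⟩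
  simpa using this

theorem norm_exp_smul_apply_sub_sub_le {B : X →L[ℂ] X} {C t : ℝ} (ht : 0 ≤ t) {x : X}
    (hB : ∀ s ∈ Set.Icc 0 t, ‖NormedSpace.exp ((s : ℂ) • B) (B x) - B x‖ ≤ C) :
    ‖NormedSpace.exp ((t : ℂ) • B) x - x - (t : ℂ) • B x‖ ≤ C * t := by
  have hd : ∀ s ∈ Set.Icc 0 t, HasDerivWithinAt
      (fun s : ℝ => NormedSpace.exp ((s : ℂ) • B) x - (s : ℂ) • B x)
      (NormedSpace.exp ((s : ℂ) • B) (B x) - B x) (Set.Icc 0 t) s := by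
    intro s _
    have h1 : HasDerivAt (fun s : ℝ => (s : ℂ) • B x) (B x) s := by
      simpa using Complex.ofRealCLM.hasDerivAt.smul_const (B x) (x := s)
    exact ((hasDerivAt_exp_smul_apply B x s).sub h1).hasDerivWithinAt
  have := norm_image_sub_le_of_norm_deriv_le_segment' hd
    (fun s hs => hB s ⟨hs.1, hs.2.le⟩) t ⟨ht, le_rfl⟩
  simp only [Complex.ofReal_zero, zero_smul, NormedSpace.exp_zero, sub_zero,
    one_apply_eq_self] at this
  rwa [sub_right_comm]

/-- The comparison of two exponentials comes from differentiating
`s ↦ e^{sB} e^{(t - s)C} x` from `0` to `t`. -/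
theorem norm_exp_smul_apply_sub_exp_le {B C : X →L[ℂ] X} (hBC : Commute B C) {K t : ℝ}
    (ht : 0 ≤ t) (hK : 0 ≤ K) (hB : ∀ s ∈ Set.Icc 0 t, ‖NormedSpace.exp ((s : ℂ) • B)‖ ≤ K)
    (hC : ∀ s ∈ Set.Icc 0 t, ‖NormedSpace.exp ((s : ℂ) • C)‖ ≤ K) (x : X) :
    ‖NormedSpace.exp ((t : ℂ) • B) x - NormedSpace.exp ((t : ℂ) • C) x‖ ≤
      K * K * ‖B x - C x‖ * t := by
  let F : ℝ → X →L[ℂ] X := fun s =>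
    NormedSpace.exp ((s : ℂ) • B) * NormedSpace.exp (((t - s : ℝ) : ℂ) • C)
  have hd : ∀ s : ℝ, HasDerivAt F (F s * (B - C)) s := by
    intro s
    have h1 := hasDerivAt_exp_smul B s
    have h2 : HasDerivAt (fun s : ℝ => NormedSpace.exp (((t - s : ℝ) : ℂ) • C))
        (-(NormedSpace.exp (((t - s : ℝ) : ℂ) • C) * C)) s := by
      have h3 : HasDerivAt (fun s : ℝ => t - s) (-1) s := (hasDerivAt_id s).const_sub t
      have h4 := (hasDerivAt_exp_smul C (t - s)).scomp s h3
      rwa [neg_one_smul] at h4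
    have hcomm : Commute B (NormedSpace.exp (((t - s : ℝ) : ℂ) • C)) :=
      (hBC.smul_right _).exp_right
    refine (h1.mul h2).congr_deriv ?_
    rw [mul_sub, mul_neg, ← sub_eq_add_neg, mul_assoc, mul_assoc, mul_assoc, hcomm.eq]
  have hd' : ∀ s ∈ Set.Icc 0 t, HasDerivWithinAt (fun s => F s x) (F s (B x - C x))
      (Set.Icc 0 t) s := fun s _ =>
    (((apply ℂ X x).restrictScalars ℝ).hasFDerivAt.comp_hasDerivAt s (hd s)).hasDerivWithinAt
  have := norm_image_sub_le_of_norm_deriv_le_segment' hd' (C := K * K * ‖B x - C x‖)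
    (fun s hs => ?_) t ⟨ht, le_rfl⟩
  · simpa [F] using this
  · refine (le_opNorm _ _).trans (mul_le_mul_of_nonneg_right ?_ (norm_nonneg _))
    exact (norm_mul_le _ _).trans (mul_le_mul (hB s ⟨hs.1, hs.2.le⟩)
      (hC _ ⟨by linarith [hs.2], by linarith [hs.1]⟩) (norm_nonneg _) hK)

end ContinuousLinearMap

/-! ### Bounded families of operators on a dense subspace -/

section Dense

variable {X ι : Type*} [NormedAddCommGroup X] [NormedSpace ℂ X]

theorem tendsto_apply_self_of_dense {S : Set X} (hS : Dense S) {l : Filter ι}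
    {T : ι → X →L[ℂ] X} {K : ℝ} (hT : ∀ᶠ i in l, ‖T i‖ ≤ K)
    (h : ∀ x ∈ S, Tendsto (fun i => T i x) l (𝓝 x)) (x : X) :
    Tendsto (fun i => T i x) l (𝓝 x) := by
  rw [Metric.tendsto_nhds]
  intro ε hε
  have hK : 0 < |K| + 2 := by positivity
  obtain ⟨y, hy, hxy⟩ := Metric.dense_iff.1 hS x (ε / (|K| + 2)) (by positivity)
  rw [Metric.mem_ball, dist_eq_norm, lt_div_iff₀ hK] at hy
  filter_upwards [hT, (Metric.tendsto_nhds.1 (h y hxy)) (‖y - x‖ + (ε - ‖y - x‖ * (|K| + 2)))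
    (by linarith [norm_nonneg (y - x)])] with i h1 h2
  rw [dist_eq_norm] at h2 ⊢
  have h3 : ‖T i (x - y)‖ ≤ |K| * ‖x - y‖ :=
    (T i).le_of_opNorm_le (h1.trans (le_abs_self K)) _
  have h4 : T i x - x = T i (x - y) + (T i y - y) + (y - x) := by
    rw [map_sub]
    abel
  rw [h4]
  refine (norm_add₃_le ..).trans_lt ?_
  rw [norm_sub_rev] at h3
  nlinarith

theorem cauchySeq_apply_of_dense [Nonempty ι] [SemilatticeSup ι] {S : Set X} (hS : Dense S)
    {T : ι → X →L[ℂ] X} {K : ℝ} (hT : ∀ᶠ i in atTop, ‖T i‖ ≤ K)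
    (h : ∀ x ∈ S, CauchySeq fun i => T i x) (x : X) : CauchySeq fun i => T i x := by
  rw [Metric.cauchySeq_iff]
  intro ε hε
  have hK : 0 < 2 * |K| + 1 := by positivity
  obtain ⟨y, hy, hyS⟩ := Metric.dense_iff.1 hS x (ε / (2 * |K| + 1)) (by positivity)
  rw [Metric.mem_ball, dist_eq_norm, lt_div_iff₀ hK] at hy
  obtain ⟨N, hN⟩ := eventually_atTop.1 hT
  obtain ⟨M, hM⟩ := Metric.cauchySeq_iff.1 (h y hyS) (ε - ‖y - x‖ * (2 * |K|))
    (by nlinarith [norm_nonneg (y - x)])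
  refine ⟨N ⊔ M, fun m hm n hn => ?_⟩
  have h1 : ∀ i, N ≤ i → ‖T i (x - y)‖ ≤ |K| * ‖y - x‖ := fun i hi => by
    rw [norm_sub_rev]
    exact (T i).le_of_opNorm_le ((hN i hi).trans (le_abs_self K)) _
  have h2 := hM m (le_sup_right.trans hm) n (le_sup_right.trans hn)
  have h3 := h1 m (le_sup_left.trans hm)
  have h4 := h1 n (le_sup_left.trans hn)
  rw [dist_eq_norm] at h2 ⊢
  have h5 : T m x - T n x = T m (x - y) + (T m y - T n y) - T n (x - y) := by
    rw [map_sub, map_sub]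
    abel
  rw [h5]
  have h6 := norm_sub_le (T m (x - y) + (T m y - T n y)) (T n (x - y))
  have h7 := norm_add_le (T m (x - y)) (T m y - T n y)
  linarith

end Dense

/-! ### The Hille–Yosida theorem -/

section HilleYosida

variable {X : Type*} [NormedAddCommGroup X] [NormedSpace ℂ X]

theorem sub_eq_of_sub_eq {G : Type*} [AddCommGroup G] {x y z : G} (h : x - y = z) : x - z = y := by
  rw [← h, sub_sub_cancel]

/-- The bounded operators `R l`, for real `l > w`, are the resolvents `(l - A)⁻¹` of the
unbounded operator `A`, and they satisfy the Hille–Yosida bound `‖R l‖ ≤ 1 / (l - w)`. The values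
of `R` on `(-∞, w]` are irrelevant. -/
structure IsResolventFamily (A : X →ₗ.[ℂ] X) (w : ℝ) (R : ℝ → X →L[ℂ] X) : Prop where
  mem : ∀ l, w < l → ∀ x, R l x ∈ A.domain
  right_inv : ∀ l (hl : w < l) x, (l : ℂ) • R l x - A ⟨R l x, mem l hl x⟩ = x
  left_inv : ∀ l, w < l → ∀ x : A.domain, R l ((l : ℂ) • (x : X) - A x) = x
  norm_le : ∀ l, w < l → ‖R l‖ ≤ (l - w)⁻¹

/-- The Yosida approximation `l² R - l = l A R` built from a resolvent `R = (l - A)⁻¹`. -/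
noncomputable def yosida (R : ℝ → X →L[ℂ] X) (l : ℝ) : X →L[ℂ] X :=
  ((l ^ 2 : ℝ) : ℂ) • R l - (l : ℂ) • (1 : X →L[ℂ] X)

namespace IsResolventFamily

variable {A : X →ₗ.[ℂ] X} {w : ℝ} {R : ℝ → X →L[ℂ] X}

theorem resolvent_identity (hR : IsResolventFamily A w R) {l m : ℝ} (hl : w < l) (hm : w < m)
    (x : X) : R l x - R m x = ((m - l : ℝ) : ℂ) • R l (R m x) := by
  have h1 := hR.left_inv l hl ⟨R m x, hR.mem m hm x⟩
  have h2 := sub_eq_of_sub_eq (hR.right_inv m hm x)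
  have h3 : (l : ℂ) • R m x - A ⟨R m x, hR.mem m hm x⟩ = x - ((m - l : ℝ) : ℂ) • R m x := by
    rw [← h2]
    push_cast
    module
  rw [h3, map_sub, map_smul] at h1
  exact sub_eq_of_sub_eq h1

theorem commute (hR : IsResolventFamily A w R) {l m : ℝ} (hl : w < l) (hm : w < m) :
    Commute (R l) (R m) := by
  rcases eq_or_ne l m with rfl | hne
  · exact Commute.refl _
  refine ContinuousLinearMap.ext fun x => ?_
  have h1 := hR.resolvent_identity hl hm x
  have h2 := hR.resolvent_identity hm hl x
  have h3 : ((m - l : ℝ) : ℂ) ≠ 0 := by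
    exact_mod_cast sub_ne_zero.2 hne.symm
  refine smul_right_injective X h3 ?_
  change ((m - l : ℝ) : ℂ) • R l (R m x) = ((m - l : ℝ) : ℂ) • R m (R l x)
  rw [← h1, ← neg_sub (R m x), h2, ← neg_smul]
  push_cast
  congr 1
  ring

theorem commute_yosida (hR : IsResolventFamily A w R) {l m : ℝ} (hl : w < l) (hm : w < m) :
    Commute (yosida R l) (yosida R m) := by
  refine Commute.sub_left (Commute.sub_right ?_ ?_) ((Commute.one_left _).smul_left _)
  · exact ((hR.commute hl hm).smul_left _).smul_right _
  · exact (Commute.one_right _).smul_right _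

theorem yosida_apply (hR : IsResolventFamily A w R) {l : ℝ} (hl : w < l) (x : A.domain) :
    yosida R l x = (l : ℂ) • R l (A x) := by
  have h1 := hR.left_inv l hl x
  rw [map_sub, map_smul, sub_eq_iff_eq_add] at h1
  have h2 : R l (A x) = (l : ℂ) • R l (x : X) - x := by
    rw [h1]
    abel
  rw [h2]
  change ((l ^ 2 : ℝ) : ℂ) • R l (x : X) - (l : ℂ) • (x : X) = _
  push_cast
  module

theorem norm_smul_resolvent_le (hR : IsResolventFamily A w R) {l : ℝ} (hl : w < l) (h0 : 0 ≤ l)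
    (h2 : 2 * w ≤ l) :
    ‖(l : ℂ) • R l‖ ≤ 2 := by
  rw [norm_smul, Complex.norm_real, Real.norm_of_nonneg h0]
  refine (mul_le_mul_of_nonneg_left (hR.norm_le l hl) h0).trans ?_
  rw [← div_eq_mul_inv, div_le_iff₀ (by linarith)]
  linarith

theorem tendsto_smul_resolvent (hR : IsResolventFamily A w R) (hd : Dense (A.domain : Set X))
    (x : X) : Tendsto (fun l : ℝ => (l : ℂ) • R l x) atTop (𝓝 x) := by
  refine tendsto_apply_self_of_dense (T := fun l : ℝ => (l : ℂ) • R l) hd (K := 2) ?_ ?_ x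
  · filter_upwards [eventually_gt_atTop w, eventually_ge_atTop 0, eventually_ge_atTop (2 * w)]
      with l hl h0 h2 using hR.norm_smul_resolvent_le hl h0 h2
  · intro y hy
    have h1 : Tendsto (fun l : ℝ => (l - w)⁻¹ * ‖A ⟨y, hy⟩‖) atTop (𝓝 0) := by
      have := (tendsto_inv_atTop_zero.comp
        (tendsto_atTop_add_const_right atTop (-w) tendsto_id)).mul_const ‖A ⟨y, hy⟩‖
      rwa [zero_mul] at this
    rw [tendsto_iff_norm_sub_tendsto_zero]
    refine squeeze_zero' (Eventually.of_forall fun _ => norm_nonneg _) ?_ h1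
    filter_upwards [eventually_gt_atTop w] with l hl
    have h2 := hR.left_inv l hl ⟨y, hy⟩
    rw [map_sub, map_smul, sub_eq_iff_eq_add] at h2
    rw [smul_apply, h2, add_sub_cancel_left]
    exact (R l).le_of_opNorm_le (hR.norm_le l hl) _

theorem tendsto_yosida (hR : IsResolventFamily A w R) (hd : Dense (A.domain : Set X))
    (x : A.domain) : Tendsto (fun l : ℝ => yosida R l x) atTop (𝓝 (A x)) := by
  refine (hR.tendsto_smul_resolvent hd (A x)).congr' ?_
  filter_upwards [eventually_gt_atTop w] with l hl
  rw [hR.yosida_apply hl]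

variable [CompleteSpace X]

theorem norm_exp_yosida_le (hR : IsResolventFamily A w R) {l : ℝ} (hl : w < l) {t : ℝ}
    (ht : 0 ≤ t) :
    ‖NormedSpace.exp ((t : ℂ) • yosida R l)‖ ≤ Real.exp (l * w / (l - w) * t) := by
  have h1 : (t : ℂ) • yosida R l =
      ((t * l ^ 2 : ℝ) : ℂ) • R l - ((t * l : ℝ) : ℂ) • (1 : X →L[ℂ] X) := by
    rw [yosida]
    push_cast
    module
  rw [h1]
  refine (ContinuousLinearMap.norm_exp_sub_smul_one_le _ _).trans (Real.exp_le_exp.2 ?_)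
  rw [norm_smul, Complex.norm_real, Real.norm_of_nonneg (by positivity)]
  have h2 : l - w ≠ 0 := by linarith
  have h3 : l * w / (l - w) * t = t * l ^ 2 * (l - w)⁻¹ - t * l := by
    field_simp
    ring
  rw [h3]
  have := hR.norm_le l hl
  gcongr

/-- A bound for the exponentials of the Yosida approximations that is uniform in the parameter. -/
theorem norm_exp_yosida_le_two (hR : IsResolventFamily A w R) (hw : 0 ≤ w) {l : ℝ} (hl : w < l)
    (hl2 : 2 * w ≤ l) {t s : ℝ} (hs : s ∈ Set.Icc 0 t) :
    ‖NormedSpace.exp ((s : ℂ) • yosida R l)‖ ≤ Real.exp (2 * w * t) := by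
  refine (hR.norm_exp_yosida_le hl hs.1).trans (Real.exp_le_exp.2 ?_)
  refine mul_le_mul ?_ hs.2 hs.1 (by positivity)
  rw [div_le_iff₀ (by linarith)]
  nlinarith

theorem exists_tendsto_exp_yosida (hR : IsResolventFamily A w R) (hw : 0 ≤ w)
    (hd : Dense (A.domain : Set X)) {t : ℝ} (ht : 0 ≤ t) (x : X) :
    ∃ y, Tendsto (fun l : ℝ => NormedSpace.exp ((t : ℂ) • yosida R l) x) atTop (𝓝 y) := by
  refine cauchySeq_tendsto_of_complete (cauchySeq_apply_of_dense hd (K := Real.exp (2 * w * t))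
    (T := fun l : ℝ => NormedSpace.exp ((t : ℂ) • yosida R l)) ?_ ?_ x)
  · filter_upwards [eventually_gt_atTop w, eventually_ge_atTop (2 * w)] with l hl h2
    exact hR.norm_exp_yosida_le_two hw hl h2 ⟨ht, le_rfl⟩
  · intro y hy
    have hc := (hR.tendsto_yosida hd ⟨y, hy⟩).cauchySeq
    rw [Metric.cauchySeq_iff] at hc ⊢
    intro ε hε
    set K := Real.exp (2 * w * t)
    have hK : 0 < K := Real.exp_pos _
    obtain ⟨N, hN⟩ := hc (ε / (K * K * t + 1)) (by positivity)
    refine ⟨N ⊔ ((w + 1) ⊔ (2 * w)), fun l hl m hm => ?_⟩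
    have hl' : w < l := by linarith [(le_sup_left.trans le_sup_right).trans hl]
    have hm' : w < m := by linarith [(le_sup_left.trans le_sup_right).trans hm]
    have h1 := ContinuousLinearMap.norm_exp_smul_apply_sub_exp_le (hR.commute_yosida hl' hm') ht
      hK.le
      (fun s hs => hR.norm_exp_yosida_le_two hw hl' ((le_sup_right.trans le_sup_right).trans hl) hs)
      (fun s hs => hR.norm_exp_yosida_le_two hw hm' ((le_sup_right.trans le_sup_right).trans hm) hs)
      y
    have h2 := hN l (le_sup_left.trans hl) m (le_sup_left.trans hm)
    rw [dist_eq_norm, lt_div_iff₀ (by positivity)] at h2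
    rw [dist_eq_norm]
    have h3 := norm_nonneg (yosida R l y - yosida R m y)
    rcases h3.eq_or_lt with h0 | h0
    · rw [← h0] at h1
      linarith
    · change ‖yosida R l y - yosida R m y‖ * _ < ε at h2
      linarith

/-- The strong limit `lim_{l → ∞} e^{t A_l}` of the exponentials of the Yosida approximations. -/
noncomputable def limitOp (hR : IsResolventFamily A w R) (hw : 0 ≤ w)
    (hd : Dense (A.domain : Set X)) (t : ℝ≥0) : X →L[ℂ] X :=
  LinearMap.mkContinuous
    (linearMapOfTendsto (fun x => (hR.exists_tendsto_exp_yosida hw hd t.2 x).choose)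
      (fun l : ℝ => (NormedSpace.exp (((t : ℝ) : ℂ) • yosida R l) : X →L[ℂ] X).toLinearMap)
      (tendsto_pi_nhds.2 fun x => (hR.exists_tendsto_exp_yosida hw hd t.2 x).choose_spec))
    (Real.exp (2 * w * t)) fun x => by
      refine le_of_tendsto (hR.exists_tendsto_exp_yosida hw hd t.2 x).choose_spec.norm ?_
      filter_upwards [eventually_gt_atTop w, eventually_ge_atTop (2 * w)] with l hl h2
      exact ContinuousLinearMap.le_of_opNorm_le _
        (hR.norm_exp_yosida_le_two hw hl h2 ⟨t.2, le_rfl⟩) x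

theorem tendsto_limitOp (hR : IsResolventFamily A w R) (hw : 0 ≤ w)
    (hd : Dense (A.domain : Set X)) (t : ℝ≥0) (x : X) :
    Tendsto (fun l : ℝ => NormedSpace.exp (((t : ℝ) : ℂ) • yosida R l) x) atTop
      (𝓝 (hR.limitOp hw hd t x)) :=
  (hR.exists_tendsto_exp_yosida hw hd t.2 x).choose_spec

theorem norm_limitOp_le (hR : IsResolventFamily A w R) (hw : 0 ≤ w)
    (hd : Dense (A.domain : Set X)) (t : ℝ≥0) : ‖hR.limitOp hw hd t‖ ≤ Real.exp (w * t) := by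
  refine ContinuousLinearMap.opNorm_le_bound _ (Real.exp_pos _).le fun x => ?_
  have h1 : Tendsto (fun l : ℝ => l * w / (l - w)) atTop (𝓝 w) := by
    have h2 : Tendsto (fun l : ℝ => w + w ^ 2 * (l - w)⁻¹) atTop (𝓝 (w + w ^ 2 * 0)) :=
      tendsto_const_nhds.add ((tendsto_inv_atTop_zero.comp
        (tendsto_atTop_add_const_right atTop (-w) tendsto_id)).const_mul _)
    rw [mul_zero, add_zero] at h2
    refine h2.congr' ?_
    filter_upwards [eventually_gt_atTop w] with l hl
    have h2 : l - w ≠ 0 := by linarith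
    field_simp
    ring
  refine le_of_tendsto_of_tendsto (hR.tendsto_limitOp hw hd t x).norm
    ((Real.continuous_exp.tendsto _).comp (h1.mul_const (t : ℝ)) |>.mul_const ‖x‖) ?_
  filter_upwards [eventually_gt_atTop w] with l hl
  exact ContinuousLinearMap.le_of_opNorm_le _ (hR.norm_exp_yosida_le hl t.2) x

theorem norm_limitOp_sub_le (hR : IsResolventFamily A w R) (hw : 0 ≤ w)
    (hd : Dense (A.domain : Set X)) (t : ℝ≥0) (x : A.domain) :
    ‖hR.limitOp hw hd t x - x‖ ≤ Real.exp (2 * w * t) * ‖A x‖ * t := by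
  refine le_of_tendsto_of_tendsto ((hR.tendsto_limitOp hw hd t x).sub_const (x : X)).norm
    (((hR.tendsto_yosida hd x).norm.const_mul _).mul_const _) ?_
  filter_upwards [eventually_gt_atTop w, eventually_ge_atTop (2 * w)] with l hl h2
  exact ContinuousLinearMap.norm_exp_smul_apply_sub_le t.2
    (fun s hs => hR.norm_exp_yosida_le_two hw hl h2 hs) _

/-- First order expansion of the orbit of `x` at `0`. The element `y` of the domain stands for an
approximation of `A x`, which itself need not lie in the domain. -/
theorem norm_limitOp_sub_sub_le (hR : IsResolventFamily A w R) (hw : 0 ≤ w)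
    (hd : Dense (A.domain : Set X)) (t : ℝ≥0) (x y : A.domain) :
    ‖hR.limitOp hw hd t x - x - ((t : ℝ) : ℂ) • A x‖ ≤
      (Real.exp (2 * w * t) * ‖A y‖ * t + (Real.exp (2 * w * t) + 1) * ‖A x - y‖) * t := by
  refine le_of_tendsto_of_tendsto (((hR.tendsto_limitOp hw hd t x).sub_const (x : X)).sub
    ((hR.tendsto_yosida hd x).const_smul ((t : ℝ) : ℂ))).norm
    (((((hR.tendsto_yosida hd y).norm.const_mul _).mul_const _).add
      (((hR.tendsto_yosida hd x).sub_const (y : X)).norm.const_mul _)).mul_const _) ?_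
  filter_upwards [eventually_gt_atTop w, eventually_ge_atTop (2 * w)] with l hl h2
  refine ContinuousLinearMap.norm_exp_smul_apply_sub_sub_le t.2 fun s hs => ?_
  have hK := hR.norm_exp_yosida_le_two hw hl h2 hs
  set E := NormedSpace.exp ((s : ℂ) • yosida R l)
  set z := yosida R l x
  have h3 : E z - z = (E y - y) + E (z - y) - (z - y) := by
    rw [map_sub]
    abel
  have h4 : ‖E y - y‖ ≤ Real.exp (2 * w * t) * ‖yosida R l y‖ * t :=
    (ContinuousLinearMap.norm_exp_smul_apply_sub_le hs.1
      (fun r hr => hR.norm_exp_yosida_le_two hw hl h2 ⟨hr.1, hr.2.trans hs.2⟩) _).trans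
      (mul_le_mul_of_nonneg_left hs.2 (by positivity))
  have h5 : ‖E (z - y)‖ ≤ Real.exp (2 * w * t) * ‖z - y‖ :=
    ContinuousLinearMap.le_of_opNorm_le _ hK _
  rw [h3]
  have h6 := norm_sub_le ((E y - y) + E (z - y)) (z - y)
  have h7 := norm_add_le (E y - y) (E (z - (y : X)))
  linarith

theorem tendsto_coe_nhdsGT_zero : Tendsto (fun t : ℝ≥0 => (t : ℝ)) (𝓝[>] 0) (𝓝 0) :=
  (NNReal.continuous_coe.tendsto' 0 0 rfl).mono_left nhdsWithin_le_nhds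

/-- The `C₀`-semigroup of the Hille–Yosida theorem. -/
noncomputable def semigroup (hR : IsResolventFamily A w R) (hw : 0 ≤ w)
    (hd : Dense (A.domain : Set X)) : C0Semigroup X where
  op := hR.limitOp hw hd
  op_zero := by
    ext x
    refine tendsto_nhds_unique (hR.tendsto_limitOp hw hd 0 x) ?_
    simp
  op_add s t := by
    ext x
    let _ : NormedAlgebra ℚ (X →L[ℂ] X) := NormedAlgebra.restrictScalars ℚ ℂ (X →L[ℂ] X)
    refine tendsto_nhds_unique (hR.tendsto_limitOp hw hd (s + t) x) ?_
    have h1 := hR.tendsto_limitOp hw hd s (hR.limitOp hw hd t x)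
    have h2 := (hR.tendsto_limitOp hw hd t x).sub_const (hR.limitOp hw hd t x)
    have h3 : Tendsto (fun l : ℝ => NormedSpace.exp (((s : ℝ) : ℂ) • yosida R l)
        (NormedSpace.exp (((t : ℝ) : ℂ) • yosida R l) x - hR.limitOp hw hd t x)) atTop (𝓝 0) := by
      refine squeeze_zero_norm' (a := fun l => Real.exp (2 * w * s) *
        ‖NormedSpace.exp (((t : ℝ) : ℂ) • yosida R l) x - hR.limitOp hw hd t x‖) ?_ ?_
      · filter_upwards [eventually_gt_atTop w, eventually_ge_atTop (2 * w)] with l hl h2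
        exact ContinuousLinearMap.le_of_opNorm_le _
          (hR.norm_exp_yosida_le_two hw hl h2 ⟨s.2, le_rfl⟩) _
      · simpa using h2.norm.const_mul (Real.exp (2 * w * s))
    have h4 := h1.add h3
    rw [add_zero] at h4
    refine h4.congr fun l => ?_
    rw [map_sub, add_sub_cancel, NNReal.coe_add, Complex.ofReal_add, add_smul,
      NormedSpace.exp_add_of_commute (((Commute.refl _).smul_left _).smul_right _)]
    rfl
  tendsto_op := by
    refine tendsto_apply_self_of_dense hd (K := Real.exp w) ?_ ?_
    · have h1 : ∀ᶠ t : ℝ≥0 in 𝓝[>] 0, t < 1 :=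
        mem_nhdsWithin_of_mem_nhds (Iio_mem_nhds one_pos)
      filter_upwards [h1] with t ht
      refine (hR.norm_limitOp_le hw hd t).trans (Real.exp_le_exp.2 ?_)
      exact mul_le_of_le_one_right hw (by exact_mod_cast ht.le)
    · intro y hy
      rw [tendsto_iff_norm_sub_tendsto_zero]
      refine squeeze_zero (fun _ => norm_nonneg _)
        (fun t => hR.norm_limitOp_sub_le hw hd t ⟨y, hy⟩) ?_
      have h1 := tendsto_coe_nhdsGT_zero
      have h2 := (((Real.continuous_exp.tendsto _).comp (h1.const_mul (2 * w))).mul_const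
        ‖A ⟨y, hy⟩‖).mul h1
      simpa using h2

theorem hasRightDeriv_semigroup (hR : IsResolventFamily A w R) (hw : 0 ≤ w)
    (hd : Dense (A.domain : Set X)) (x : A.domain) :
    (hR.semigroup hw hd).HasRightDeriv x (A x) := by
  rw [C0Semigroup.HasRightDeriv, Metric.tendsto_nhds]
  intro ε hε
  obtain ⟨y, hy, hyd⟩ := Metric.dense_iff.1 hd (A x) (ε / 3) (by positivity)
  rw [Metric.mem_ball, dist_eq_norm, norm_sub_rev] at hy
  have h1 := tendsto_coe_nhdsGT_zero
  have h2 := (Real.continuous_exp.tendsto _).comp (h1.const_mul (2 * w))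
  have h3 := ((h2.mul_const ‖A ⟨y, hyd⟩‖).mul h1).add
    ((h2.add_const 1).mul_const ‖A x - y‖)
  simp only [mul_zero, Real.exp_zero, zero_add, one_mul] at h3
  have h4 := h3.eventually_lt_const (u := ε) (by linarith)
  filter_upwards [h4, self_mem_nhdsWithin] with t ht h0
  have h0' : (0 : ℝ) < t := h0
  have h5 := hR.norm_limitOp_sub_sub_le hw hd t x ⟨y, hyd⟩
  have h6 : (((t : ℝ) : ℂ)⁻¹ • ((hR.semigroup hw hd).op t x - x) - A x : X) =
      ((t : ℝ) : ℂ)⁻¹ • (hR.limitOp hw hd t x - x - ((t : ℝ) : ℂ) • A x) := by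
    rw [smul_sub _ (_ - _), inv_smul_smul₀ (by exact_mod_cast h0'.ne')]
    rfl
  rw [dist_eq_norm, h6, norm_smul, norm_inv, Complex.norm_real, Real.norm_of_nonneg h0'.le]
  refine lt_of_le_of_lt ?_ ht
  rw [inv_mul_le_iff₀ h0', mul_comm]
  exact h5

end IsResolventFamily

namespace C0Semigroup

/-- An eigenvalue `l` of the generator of a semigroup that is bounded by `e^{wt}` is at most
`w`: compare the growth rates of the eigenvector's orbit at `0`. -/
theorem HasRightDeriv.eq_zero_of_lt {U : C0Semigroup X} {w l : ℝ}
    (hU : ∀ t : ℝ≥0, ‖U.op t‖ ≤ Real.exp (w * t)) (hl : w < l) {x : X}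
    (hx : U.HasRightDeriv x ((l : ℂ) • x)) : x = 0 := by
  by_contra hne
  have hx0 : 0 < ‖x‖ := norm_pos_iff.2 hne
  have h1 : Tendsto (fun t : ℝ≥0 => ((Real.exp (w * t) - 1) / t) * ‖x‖ +
      ‖((t : ℝ) : ℂ)⁻¹ • (U.op t x - x) - (l : ℂ) • x‖) (𝓝[>] 0) (𝓝 (w * ‖x‖ + 0)) := by
    refine Tendsto.add (Tendsto.mul_const _ ?_) (tendsto_iff_norm_sub_tendsto_zero.1 hx)
    have h2 : HasDerivAt (fun t : ℝ => Real.exp (w * t)) w 0 := by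
      simpa using ((hasDerivAt_id (0 : ℝ)).const_mul w).exp
    have h3 := h2.tendsto_slope_zero_right
    have h4 : Tendsto (fun t : ℝ≥0 => (t : ℝ)) (𝓝[>] 0) (𝓝[>] 0) := by
      refine tendsto_nhdsWithin_iff.2 ⟨IsResolventFamily.tendsto_coe_nhdsGT_zero, ?_⟩
      filter_upwards [self_mem_nhdsWithin] with t ht using NNReal.coe_pos.2 ht
    refine (h3.comp h4).congr fun t => ?_
    simp [div_eq_inv_mul]
  have h2 : l * ‖x‖ ≤ w * ‖x‖ + 0 := by
    refine ge_of_tendsto h1 ?_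
    filter_upwards [self_mem_nhdsWithin] with t ht
    have ht' : (0 : ℝ) < t := ht
    set q := ((t : ℝ) : ℂ)⁻¹ • (U.op t x - x)
    have h3 : ((1 + t * l : ℝ) : ℂ) • x = U.op t x - ((t : ℝ) : ℂ) • (q - (l : ℂ) • x) := by
      rw [smul_sub, smul_inv_smul₀ (by exact_mod_cast ht'.ne')]
      push_cast
      module
    have h4 : (1 + t * l) * ‖x‖ ≤ Real.exp (w * t) * ‖x‖ + t * ‖q - (l : ℂ) • x‖ := by
      calc (1 + t * l) * ‖x‖ ≤ ‖((1 + t * l : ℝ) : ℂ) • x‖ := by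
            rw [norm_smul, Complex.norm_real]
            gcongr
            exact Real.le_norm_self _
        _ ≤ ‖U.op t x‖ + ‖((t : ℝ) : ℂ) • (q - (l : ℂ) • x)‖ := by
            rw [h3]
            exact norm_sub_le _ _
        _ ≤ _ := by
            rw [norm_smul, Complex.norm_real, Real.norm_of_nonneg ht'.le]
            gcongr
            exact ContinuousLinearMap.le_of_opNorm_le _ (hU t) x
    rw [← mul_le_mul_iff_right₀ ht', mul_add, ← mul_assoc, ← mul_assoc, mul_div_cancel₀ _ ht'.ne']
    linarith
  nlinarith

end C0Semigroup

/-- A semigroup whose generator extends `A` has no larger generator than `A`, because `l - A` is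
surjective for large `l` while `l` minus the generator is injective. -/
theorem IsResolventFamily.generator_eq {A : X →ₗ.[ℂ] X} {w : ℝ} {R : ℝ → X →L[ℂ] X}
    (hR : IsResolventFamily A w R) {U : C0Semigroup X}
    (hU : ∀ t : ℝ≥0, ‖U.op t‖ ≤ Real.exp (w * t))
    (hA : ∀ x : A.domain, U.HasRightDeriv x (A x)) : U.generator = A := by
  have hval : ∀ x : U.generator.domain, U.HasRightDeriv x (U.generator x) :=
    fun x => x.2.choose_spec
  have hle : U.generator ≤ A := by
    refine ⟨fun x hx => ?_, fun x y hxy => ?_⟩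
    · have h1 := hval ⟨x, hx⟩
      obtain ⟨l, hl⟩ := exists_gt w
      generalize U.generator ⟨x, hx⟩ = g at h1
      obtain ⟨y, hy, h2⟩ : ∃ y, ∃ hy : y ∈ A.domain,
          (l : ℂ) • y - A ⟨y, hy⟩ = (l : ℂ) • x - g :=
        ⟨_, hR.mem l hl _, hR.right_inv l hl _⟩
      have h3 := h1.add ((hA ⟨y, hy⟩).smul (-1))
      have h4 : g + (-1 : ℂ) • A ⟨y, hy⟩ = (l : ℂ) • (x + (-1 : ℂ) • y) := by
        rw [← sub_eq_of_sub_eq h2]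
        module
      rw [h4] at h3
      have h6 : x + (-1 : ℂ) • y = 0 := h3.eq_zero_of_lt hU hl
      rw [neg_one_smul, ← sub_eq_add_neg, sub_eq_zero] at h6
      rw [h6]
      exact hy
    · refine (hval x).unique ?_
      rw [hxy]
      exact hA y
  exact LinearPMap.eq_of_le_of_domain_eq hle
    (le_antisymm hle.1 fun x hx => ⟨_, hA ⟨x, hx⟩⟩)

/-- The **Hille–Yosida theorem**. -/
theorem IsResolventFamily.exists_semigroup [CompleteSpace X] {A : X →ₗ.[ℂ] X} {w : ℝ}
    {R : ℝ → X →L[ℂ] X} (hR : IsResolventFamily A w R) (hw : 0 ≤ w)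
    (hd : Dense (A.domain : Set X)) :
    ∃ U : C0Semigroup X, U.generator = A ∧ ∀ t : ℝ≥0, ‖U.op t‖ ≤ Real.exp (w * t) :=
  ⟨hR.semigroup hw hd, hR.generator_eq (hR.norm_limitOp_le hw hd)
    (hR.hasRightDeriv_semigroup hw hd), hR.norm_limitOp_le hw hd⟩

end HilleYosida

/-! ### The Lumer–Phillips theorem in a Hilbert space -/

section LumerPhillips

variable {X : Type*} [NormedAddCommGroup X] [InnerProductSpace ℂ X] {A : X →ₗ.[ℂ] X} {w : ℝ}

theorem re_inner_smul_self (c : ℝ) (x : X) : (⟪x, (c : ℂ) • x⟫_ℂ).re = c * ‖x‖ ^ 2 := by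
  rw [inner_smul_right, Complex.re_ofReal_mul]
  exact congrArg _ (inner_self_eq_norm_sq (𝕜 := ℂ) x)

theorem norm_smul_sub_apply_ge (hA : ∀ x : A.domain, (⟪(x : X), A x⟫_ℂ).re ≤ w * ‖(x : X)‖ ^ 2)
    (l : ℝ) (x : A.domain) : (l - w) * ‖(x : X)‖ ≤ ‖(l : ℂ) • (x : X) - A x‖ := by
  rcases (norm_nonneg (x : X)).eq_or_lt with h0 | h0
  · rw [← h0, mul_zero]
    exact norm_nonneg _
  have h1 : (⟪(x : X), (l : ℂ) • (x : X) - A x⟫_ℂ).re = l * ‖(x : X)‖ ^ 2 -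
      (⟪(x : X), A x⟫_ℂ).re := by
    rw [inner_sub_right, Complex.sub_re, re_inner_smul_self]
  have h2 := Complex.re_le_norm ⟪(x : X), (l : ℂ) • (x : X) - A x⟫_ℂ
  have h3 := norm_inner_le_norm (𝕜 := ℂ) (x : X) ((l : ℂ) • (x : X) - A x)
  have h4 := hA x
  refine le_of_mul_le_mul_left ?_ h0
  linarith

theorem exists_isResolventFamily
    (hA : ∀ x : A.domain, (⟪(x : X), A x⟫_ℂ).re ≤ w * ‖(x : X)‖ ^ 2)
    (hs : ∀ l : ℝ, w < l → ∀ y, ∃ x : A.domain, (l : ℂ) • (x : X) - A x = y) :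
    ∃ R, IsResolventFamily A w R := by
  have key : ∀ l : ℝ, ∃ R : X →L[ℂ] X, w < l → ∃ hm : ∀ x, R x ∈ A.domain,
      (∀ x, (l : ℂ) • R x - A ⟨R x, hm x⟩ = x) ∧
      (∀ x : A.domain, R ((l : ℂ) • (x : X) - A x) = x) ∧ ‖R‖ ≤ (l - w)⁻¹ := by
    intro l
    by_cases hl : w < l
    · let T : A.domain →ₗ[ℂ] X := (l : ℂ) • A.domain.subtype - A.toFun
      have hT : Function.Bijective T := by
        refine ⟨(injective_iff_map_eq_zero T).2 fun x hx => ?_, hs l hl⟩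
        have h1 := norm_smul_sub_apply_ge hA l x
        change (l : ℂ) • (x : X) - A x = 0 at hx
        rw [hx, norm_zero] at h1
        have h2 : ‖(x : X)‖ ≤ 0 := nonpos_of_mul_nonpos_right h1 (sub_pos.2 hl)
        exact Subtype.ext (norm_le_zero_iff.1 h2)
      let e := LinearEquiv.ofBijective T hT
      have he : ∀ x, (l : ℂ) • (e.symm x : X) - A (e.symm x) = x := e.apply_symm_apply
      have hb : ∀ x, ‖(e.symm x : X)‖ ≤ (l - w)⁻¹ * ‖x‖ := fun x => by
        rw [le_inv_mul_iff₀ (sub_pos.2 hl)]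
        simpa only [he] using norm_smul_sub_apply_ge hA l (e.symm x)
      refine ⟨(A.domain.subtype ∘ₗ e.symm.toLinearMap).mkContinuous _ hb, fun _ =>
        ⟨fun x => (e.symm x).2, he, fun x => ?_, LinearMap.mkContinuous_norm_le _ ?_ _⟩⟩
      · exact congrArg Subtype.val (e.symm_apply_apply x)
      · exact inv_nonneg.2 (sub_pos.2 hl).le
    · exact ⟨0, fun h => absurd h hl⟩
  choose R hR using key
  exact ⟨R, fun l hl => (hR l hl).choose, fun l hl => (hR l hl).choose_spec.1,
    fun l hl => (hR l hl).choose_spec.2.1, fun l hl => (hR l hl).choose_spec.2.2⟩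

/-- If `x` is orthogonal to the domain and `x = l y - A y`, then dissipativity gives `y = 0`. -/
theorem dense_domain_of_dissipative [CompleteSpace X]
    (hA : ∀ x : A.domain, (⟪(x : X), A x⟫_ℂ).re ≤ w * ‖(x : X)‖ ^ 2)
    (hs : ∀ l : ℝ, w < l → ∀ y, ∃ x : A.domain, (l : ℂ) • (x : X) - A x = y) :
    Dense (A.domain : Set X) := by
  rw [Submodule.dense_iff_topologicalClosure_eq_top, Submodule.topologicalClosure_eq_top_iff,
    Submodule.eq_bot_iff]
  intro x hx
  obtain ⟨l, hl⟩ := exists_gt w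
  obtain ⟨y, rfl⟩ := hs l hl x
  have h1 : (⟪(y : X), (l : ℂ) • (y : X) - A y⟫_ℂ).re = l * ‖(y : X)‖ ^ 2 -
      (⟪(y : X), A y⟫_ℂ).re := by
    rw [inner_sub_right, Complex.sub_re, re_inner_smul_self]
  rw [hx y y.2, Complex.zero_re] at h1
  have h2 := hA y
  have h3 : ‖(y : X)‖ ^ 2 ≤ 0 := by
    refine nonpos_of_mul_nonpos_right (a := l - w) ?_ (sub_pos.2 hl)
    linarith
  have h4 : y = 0 := Subtype.ext (norm_eq_zero.1 (pow_eq_zero_iff two_ne_zero |>.1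
    (le_antisymm h3 (sq_nonneg _))))
  rw [h4, LinearPMap.map_zero]
  simp

/-- The **Lumer–Phillips theorem** in a Hilbert space; here the domain of `A` is automatically
dense. -/
theorem exists_semigroup_of_dissipative [CompleteSpace X] (hw : 0 ≤ w)
    (hA : ∀ x : A.domain, (⟪(x : X), A x⟫_ℂ).re ≤ w * ‖(x : X)‖ ^ 2)
    (hs : ∀ l : ℝ, w < l → ∀ y, ∃ x : A.domain, (l : ℂ) • (x : X) - A x = y) :
    ∃ U : C0Semigroup X, U.generator = A ∧ ∀ t : ℝ≥0, ‖U.op t‖ ≤ Real.exp (w * t) := by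
  obtain ⟨R, hR⟩ := exists_isResolventFamily hA hs
  exact hR.exists_semigroup hw (dense_domain_of_dissipative hA hs)

end LumerPhillips

/-! ### A coercive variational problem -/

/-- A special case of the Lax–Milgram theorem: the operator `1 + J* M J` is coercive. -/
theorem exists_inner_add_inner_eq {V H : Type*} [NormedAddCommGroup V] [InnerProductSpace ℂ V]
    [CompleteSpace V] [NormedAddCommGroup H] [InnerProductSpace ℂ H] [CompleteSpace H]
    (J : V →L[ℂ] H) (M : H →L[ℂ] H) (hM : ∀ u, 0 ≤ (⟪u, M u⟫_ℂ).re) (g : H) :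
    ∃ v : V, ∀ u, ⟪u, v⟫_ℂ + ⟪J u, M (J v)⟫_ℂ = ⟪J u, g⟫_ℂ := by
  let T : V →L[ℂ] V :=
    ContinuousLinearMap.id ℂ _ + (ContinuousLinearMap.adjoint J).comp (M.comp J)
  have hT : ∀ u v, ⟪u, T v⟫_ℂ = ⟪u, v⟫_ℂ + ⟪J u, M (J v)⟫_ℂ := by
    intro u v
    change ⟪u, v + ContinuousLinearMap.adjoint J (M (J v))⟫_ℂ = _
    rw [inner_add_right, ContinuousLinearMap.adjoint_inner_right]
  have hunit : IsUnit T := by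
    refine ContinuousLinearMap.isUnit_of_forall_le_norm_inner_map T one_pos fun u => ?_
    rw [norm_inner_symm, NNReal.coe_one, mul_one]
    refine le_trans ?_ (Complex.re_le_norm _)
    rw [hT, Complex.add_re, ← inner_self_eq_norm_sq (𝕜 := ℂ) u]
    exact le_add_of_nonneg_right (hM _)
  obtain ⟨v, hv⟩ := (ContinuousLinearMap.isUnit_iff_bijective.1 hunit).2
    (ContinuousLinearMap.adjoint J g)
  refine ⟨v, fun u => ?_⟩
  rw [← hT, hv, ContinuousLinearMap.adjoint_inner_right]

/-! ### The form and the multiplication operator -/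

namespace DampedWave

variable {d : ℕ} {Ω : Opens (EuclideanSpace ℝ (Fin d))} {a b : EuclideanSpace ℝ (Fin d) → ℝ}

theorem H1.inner_formDomain (h : H1 Ω a b) (φ ψ : FormDomain Ω b) :
    ⟪φ, ψ⟫_ℂ = sForm φ ψ + ((1 - infOn Ω b : ℝ) : ℂ) * ⟪toL2 Ω b φ, toL2 Ω b ψ⟫_ℂ := by
  have h0 : ⟪φ, ψ⟫_ℂ = ⟪toL2 Ω b φ, toL2 Ω b ψ⟫_ℂ +
      (⟪grad Ω b φ, grad Ω b ψ⟫_ℂ + ⟪φ.1.snd.snd, ψ.1.snd.snd⟫_ℂ) := rfl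
  have h1 : ∫ x in (Ω : Set (EuclideanSpace ℝ (Fin d))),
      conj (toL2 Ω b φ x) * ((b x : ℂ) * toL2 Ω b ψ x) =
      ⟪φ.1.snd.snd, ψ.1.snd.snd⟫_ℂ + (infOn Ω b : ℂ) * ⟪toL2 Ω b φ, toL2 Ω b ψ⟫_ℂ := by
    have i1 := MeasureTheory.L2.integrable_inner (𝕜 := ℂ) φ.1.snd.snd ψ.1.snd.snd
    have i2 := MeasureTheory.L2.integrable_inner (𝕜 := ℂ) (toL2 Ω b φ) (toL2 Ω b ψ)
    rw [MeasureTheory.L2.inner_def, MeasureTheory.L2.inner_def, ← integral_const_mul,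
      ← integral_add i1 (i2.const_mul _)]
    refine integral_congr_ae ?_
    filter_upwards [weight_ae φ, weight_ae ψ, h.infOn_le] with x h1 h2 h3
    have : (b x : ℂ) = (weight Ω b x : ℂ) * weight Ω b x + infOn Ω b := by
      rw [weight, ← Complex.ofReal_mul, Real.mul_self_sqrt (by linarith)]
      simp
    simp only [RCLike.inner_apply, h1, h2, this, map_mul, Complex.conj_ofReal]
    ring
  rw [h0, sForm, h1]
  push_cast
  ring

theorem norm_toL2_le (u : FormDomain Ω b) : ‖toL2 Ω b u‖ ≤ 1 * ‖u‖ := by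
  rw [one_mul]
  exact WithLp.norm_fst_le (p := 2) _ u.1

/-- The embedding of `D(s₀)` into `L²(Ω)` as a bounded operator. -/
noncomputable def toL2CLM (Ω : Opens (EuclideanSpace ℝ (Fin d)))
    (b : EuclideanSpace ℝ (Fin d) → ℝ) : FormDomain Ω b →L[ℂ] L2 Ω :=
  (toL2 Ω b).mkContinuous 1 norm_toL2_le

theorem norm_mulA_le (h : H1 Ω a b) (ψ : L2 Ω) :
    ‖mulA h ψ‖ ≤ (eLpNormEssSup a (vol Ω)).toReal * ‖ψ‖ := by
  refine Lp.norm_le_mul_norm_of_ae_le_mul ?_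
  have hfin : eLpNormEssSup a (vol Ω) ≠ ⊤ := by
    rw [← eLpNorm_exponent_top]
    exact h.memLp_a.eLpNorm_ne_top
  filter_upwards [(h.memLp_mul ψ).coeFn_toLp, enorm_ae_le_eLpNormEssSup a (vol Ω)] with x h1 h2
  change ‖(h.memLp_mul ψ).toLp _ x‖ ≤ _
  rw [h1, norm_mul, Complex.norm_real]
  gcongr
  rw [← toReal_enorm]
  exact ENNReal.toReal_mono hfin h2

/-- Multiplication by `a` as a bounded operator on `L²(Ω)`. -/
noncomputable def mulACLM (h : H1 Ω a b) : L2 Ω →L[ℂ] L2 Ω :=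
  (mulA h).mkContinuous _ (norm_mulA_le h)

theorem H1.infOn_a_le (h : H1 Ω a b) : ∀ᵐ x ∂(vol Ω), infOn Ω a ≤ a x := by
  refine ae_essInf_le ⟨-(eLpNormEssSup a (vol Ω)).toReal, ?_⟩
  have hfin : eLpNormEssSup a (vol Ω) ≠ ⊤ := by
    rw [← eLpNorm_exponent_top]
    exact h.memLp_a.eLpNorm_ne_top
  rw [eventually_map]
  filter_upwards [enorm_ae_le_eLpNormEssSup a (vol Ω)] with x h2
  have h3 := ENNReal.toReal_mono hfin h2
  rw [toReal_enorm] at h3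
  exact (abs_le.1 h3).1

theorem H1.le_re_inner_mulA (h : H1 Ω a b) (ψ : L2 Ω) :
    infOn Ω a * ‖ψ‖ ^ 2 ≤ (⟪ψ, mulA h ψ⟫_ℂ).re := by
  have h1 : (⟪ψ, mulA h ψ - (infOn Ω a : ℂ) • ψ⟫_ℂ).re =
      (⟪ψ, mulA h ψ⟫_ℂ).re - infOn Ω a * ‖ψ‖ ^ 2 := by
    rw [inner_sub_right, Complex.sub_re, re_inner_smul_self]
  have h2 : ⟪ψ, mulA h ψ - (infOn Ω a : ℂ) • ψ⟫_ℂ =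
      ((∫ x in (Ω : Set (EuclideanSpace ℝ (Fin d))), (a x - infOn Ω a) * ‖ψ x‖ ^ 2 : ℝ) : ℂ) := by
    rw [← integral_complex_ofReal, MeasureTheory.L2.inner_def]
    refine integral_congr_ae ?_
    filter_upwards [(h.memLp_mul ψ).coeFn_toLp, Lp.coeFn_sub (mulA h ψ) ((infOn Ω a : ℂ) • ψ),
      Lp.coeFn_smul (infOn Ω a : ℂ) ψ] with x k1 k2 k3
    change mulA h ψ x = _ at k1
    rw [k2, Pi.sub_apply, k1, k3, Pi.smul_apply, smul_eq_mul, ← sub_mul, RCLike.inner_apply,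
      mul_assoc, Complex.mul_conj, Complex.normSq_eq_norm_sq]
    push_cast
    ring
  rw [h2, Complex.ofReal_re] at h1
  rw [← sub_nonneg, ← h1]
  refine integral_nonneg_of_ae ?_
  filter_upwards [h.infOn_a_le] with x hx
  exact mul_nonneg (sub_nonneg.2 hx) (sq_nonneg _)

/-! ### The damped wave operator -/

theorem toL2_comp₂ (h : H1 Ω a b) (Ψ : waveDomain h) : toL2 Ω b (comp₂ h Ψ) = Ψ.1.snd :=
  congrArg Subtype.val ((LinearEquiv.ofInjective (toL2 Ω b) toL2_injective).apply_symm_apply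
    ⟨Ψ.1.snd, Ψ.2.2⟩)

/-- The value of `A_α` in terms of the form `s₀`, free of the inverse of the embedding of
`D(s₀)`. -/
theorem exists_dampedWaveOp_eq (h : H1 Ω a b) (α : ℝ) (Ψ : (dampedWaveOp h α).domain) :
    ∃ (χ : FormDomain Ω b) (f : L2 Ω), toL2 Ω b χ = Ψ.1.snd ∧ IsS0 Ψ.1.fst f ∧
      dampedWaveOp h α Ψ = WithLp.toLp 2 (χ, -f - (α : ℂ) • mulA h Ψ.1.snd) :=
  ⟨comp₂ h Ψ, opS0 h (comp₁ h Ψ), toL2_comp₂ h Ψ, (comp₁ h Ψ).2.choose_spec, rfl⟩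

/-- The real part of `(Ψ, A_α Ψ)`: the terms containing `S₀ψ₁` cancel. -/
theorem re_inner_dampedWaveOp (h : H1 Ω a b) (α : ℝ) (Ψ : (dampedWaveOp h α).domain) :
    (⟪(Ψ : StateSpace Ω b), dampedWaveOp h α Ψ⟫_ℂ).re =
      (1 - infOn Ω b) * (⟪Ψ.1.snd, toL2 Ω b Ψ.1.fst⟫_ℂ).re -
        α * (⟪Ψ.1.snd, mulA h Ψ.1.snd⟫_ℂ).re := by
  obtain ⟨χ, f, hχ, hf, hA⟩ := exists_dampedWaveOp_eq h α Ψ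
  have h0 : ⟪(Ψ : StateSpace Ω b), dampedWaveOp h α Ψ⟫_ℂ = ⟪Ψ.1.fst, χ⟫_ℂ +
      ⟪Ψ.1.snd, -f - (α : ℂ) • mulA h Ψ.1.snd⟫_ℂ := by
    rw [hA]
    rfl
  have h1 : (⟪Ψ.1.fst, χ⟫_ℂ).re = (⟪χ, Ψ.1.fst⟫_ℂ).re :=
    inner_re_symm (𝕜 := ℂ) (E := FormDomain Ω b) Ψ.1.fst χ
  rw [h0, Complex.add_re, h1, h.inner_formDomain, hf χ, hχ, inner_sub_right, inner_neg_right,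
    inner_smul_right]
  simp only [Complex.add_re, Complex.sub_re, Complex.neg_re, Complex.re_ofReal_mul]
  ring

theorem re_inner_dampedWaveOp_le (h : H1 Ω a b) {α : ℝ} (hα : 0 ≤ α)
    (Ψ : (dampedWaveOp h α).domain) :
    (⟪(Ψ : StateSpace Ω b), dampedWaveOp h α Ψ⟫_ℂ).re ≤
      (1 + α * |infOn Ω a| + |infOn Ω b|) * ‖(Ψ : StateSpace Ω b)‖ ^ 2 := by
  rw [re_inner_dampedWaveOp, WithLp.prod_norm_sq_eq_of_L2]
  have h1 := norm_toL2_le Ψ.1.fst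
  have h2 := h.le_re_inner_mulA Ψ.1.snd
  have h3 := (Complex.abs_re_le_norm _).trans
    (norm_inner_le_norm (𝕜 := ℂ) Ψ.1.snd (toL2 Ω b Ψ.1.fst))
  have h4 : -|infOn Ω a| * ‖Ψ.1.snd‖ ^ 2 ≤ (⟪Ψ.1.snd, mulA h Ψ.1.snd⟫_ℂ).re :=
    (mul_le_mul_of_nonneg_right (neg_abs_le _) (sq_nonneg _)).trans h2
  have h5 : |1 - infOn Ω b| ≤ 1 + |infOn Ω b| := by
    simpa using abs_sub (1 : ℝ) (infOn Ω b)
  have h6 := mul_le_mul_of_nonneg_left h4 hα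
  have h7 : (1 - infOn Ω b) * (⟪Ψ.1.snd, toL2 Ω b Ψ.1.fst⟫_ℂ).re ≤
      (1 + |infOn Ω b|) * (‖Ψ.1.snd‖ * ‖Ψ.1.fst‖) := by
    refine (le_abs_self _).trans ?_
    rw [abs_mul]
    refine mul_le_mul h5 (h3.trans ?_) (abs_nonneg _) (by positivity)
    rw [one_mul] at h1
    gcongr
  have h8 : ‖Ψ.1.snd‖ * ‖Ψ.1.fst‖ ≤ ‖Ψ.1.fst‖ ^ 2 + ‖Ψ.1.snd‖ ^ 2 := by
    nlinarith [sq_nonneg (‖Ψ.1.snd‖ - ‖Ψ.1.fst‖), sq_nonneg ‖Ψ.1.snd‖, sq_nonneg ‖Ψ.1.fst‖]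
  have h9 := mul_le_mul_of_nonneg_left h8 (by positivity : 0 ≤ 1 + |infOn Ω b|)
  have h10 : 0 ≤ α * |infOn Ω a| * ‖Ψ.1.fst‖ ^ 2 := by positivity
  linarith

/-- For large `l` the equation `S₀ψ + (l² + lαa)ψ = g` is solvable in `D(S₀)`: the corresponding
form is bounded and coercive on `D(s₀)`. -/
theorem exists_isS0 (h : H1 Ω a b) {α : ℝ} (hα : 0 ≤ α) {l : ℝ}
    (hl : 1 + α * |infOn Ω a| + |infOn Ω b| < l) (g : L2 Ω) :
    ∃ ψ : FormDomain Ω b, IsS0 ψ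
      (g - ((l ^ 2 : ℝ) : ℂ) • toL2 Ω b ψ - ((l * α : ℝ) : ℂ) • mulA h (toL2 Ω b ψ)) := by
  -- In terms of the inner product of `D(s₀)` the form is `(φ, ψ) ↦ ⟪φ, ψ⟫ + (φ, Mψ)`.
  let M : L2 Ω →L[ℂ] L2 Ω := ((l ^ 2 + infOn Ω b - 1 : ℝ) : ℂ) • ContinuousLinearMap.id ℂ _ +
    ((l * α : ℝ) : ℂ) • mulACLM h
  have hM : ∀ u, M u = ((l ^ 2 + infOn Ω b - 1 : ℝ) : ℂ) • u + ((l * α : ℝ) : ℂ) • mulA h u :=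
    fun _ => rfl
  have hl0 : 1 ≤ l := by
    have : 0 ≤ α * |infOn Ω a| := by positivity
    linarith [abs_nonneg (infOn Ω b)]
  have hpos : ∀ u, 0 ≤ (⟪u, M u⟫_ℂ).re := by
    intro u
    have h1 : (⟪u, M u⟫_ℂ).re = (l ^ 2 + infOn Ω b - 1) * ‖u‖ ^ 2 +
        l * α * (⟪u, mulA h u⟫_ℂ).re := by
      rw [hM, inner_add_right, Complex.add_re, re_inner_smul_self, inner_smul_right,
        Complex.re_ofReal_mul]
    have h2 : -|infOn Ω a| * ‖u‖ ^ 2 ≤ (⟪u, mulA h u⟫_ℂ).re :=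
      (mul_le_mul_of_nonneg_right (neg_abs_le _) (sq_nonneg _)).trans (h.le_re_inner_mulA u)
    have h3 := mul_le_mul_of_nonneg_left h2 (by positivity : 0 ≤ l * α)
    have h4 : 0 ≤ l ^ 2 + infOn Ω b - 1 - l * α * |infOn Ω a| := by
      have h5 := neg_abs_le (infOn Ω b)
      have h6 : 1 * (1 + |infOn Ω b|) ≤ l * (l - α * |infOn Ω a|) := by
        refine mul_le_mul hl0 (by linarith) (by positivity) (by linarith)
      linarith
    have h5 := mul_nonneg h4 (sq_nonneg ‖u‖)
    rw [h1]
    linarith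
  obtain ⟨ψ, hψ⟩ := exists_inner_add_inner_eq (V := FormDomain Ω b) (H := L2 Ω)
    (toL2CLM Ω b) M hpos g
  refine ⟨ψ, fun φ => ?_⟩
  have h1 : ⟪φ, ψ⟫_ℂ + ⟪toL2 Ω b φ, M (toL2 Ω b ψ)⟫_ℂ = ⟪toL2 Ω b φ, g⟫_ℂ := hψ φ
  rw [inner_sub_right, inner_sub_right, ← h1, h.inner_formDomain, hM, inner_add_right,
    inner_smul_right, inner_smul_right, inner_smul_right]
  push_cast
  ring

theorem dampedWaveOp_apply (h : H1 Ω a b) (α : ℝ) {ψ χ : FormDomain Ω b} {f : L2 Ω}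
    (hf : IsS0 ψ f) (hm : (WithLp.toLp 2 (ψ, toL2 Ω b χ) : StateSpace Ω b) ∈ waveDomain h) :
    dampedWaveOp h α ⟨WithLp.toLp 2 (ψ, toL2 Ω b χ), hm⟩ =
      WithLp.toLp 2 (χ, -f - (α : ℂ) • mulA h (toL2 Ω b χ)) := by
  obtain ⟨χ', f', hχ, hf', hA⟩ := exists_dampedWaveOp_eq h α ⟨_, hm⟩
  have h1 : χ' = χ := toL2_injective hχ
  have h2 : f' = f := h.eq_of_inner fun φ => (hf' φ).symm.trans (hf φ)
  rw [hA, h1, h2]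
  rfl

/-- Elimination of `ψ₂ = lψ₁ - f₁` reduces `(l - A_α){ψ₁, ψ₂} = {f₁, f₂}` to
`S₀ψ₁ + (l² + lαa)ψ₁ = f₂ + (l + αa)f₁`. -/
theorem exists_smul_sub_dampedWaveOp_eq (h : H1 Ω a b) {α : ℝ} (hα : 0 ≤ α) {l : ℝ}
    (hl : 1 + α * |infOn Ω a| + |infOn Ω b| < l) (F : StateSpace Ω b) :
    ∃ Ψ : (dampedWaveOp h α).domain, (l : ℂ) • (Ψ : StateSpace Ω b) - dampedWaveOp h α Ψ = F := by
  obtain ⟨ψ, hψ⟩ := exists_isS0 h hα hl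
    (F.snd + (l : ℂ) • toL2 Ω b F.fst + (α : ℂ) • mulA h (toL2 Ω b F.fst))
  let χ : FormDomain Ω b := (l : ℂ) • ψ - F.fst
  have hm : (WithLp.toLp 2 (ψ, toL2 Ω b χ) : StateSpace Ω b) ∈ waveDomain h :=
    ⟨⟨_, hψ⟩, ⟨χ, rfl⟩⟩
  refine ⟨⟨_, hm⟩, ?_⟩
  rw [dampedWaveOp_apply h α hψ hm]
  refine WithLp.ofLp_injective 2 (Prod.ext ?_ ?_)
  · change (l : ℂ) • ψ - χ = F.fst
    simp only [χ, sub_sub_cancel]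
  · change (l : ℂ) • toL2 Ω b χ - (-_ - (α : ℂ) • mulA h (toL2 Ω b χ)) = F.snd
    simp only [χ, map_sub, map_smul]
    push_cast
    module

/-- The sharper bound obtained from dissipativity, with half the required growth rate. -/
theorem exists_semigroup_dampedWaveOp (h : H1 Ω a b) {α : ℝ} (hα : 0 ≤ α) :
    ∃ U : C0Semigroup (StateSpace Ω b), U.generator = dampedWaveOp h α ∧
      ∀ t : ℝ≥0, ‖U.op t‖ ≤ Real.exp ((1 + α * |infOn Ω a| + |infOn Ω b|) * t) :=
  exists_semigroup_of_dissipative (X := StateSpace Ω b) (A := dampedWaveOp h α) (by positivity)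
    (re_inner_dampedWaveOp_le h hα) fun _ hl => exists_smul_sub_dampedWaveOp_eq h hα hl

end DampedWave

theorem mainTheorem4 {d : ℕ} (hd : 1 ≤ d) (Ω : TopologicalSpace.Opens (EuclideanSpace ℝ (Fin d)))
    (hΩ : IsConnected (Ω : Set (EuclideanSpace ℝ (Fin d))))
    (a b : EuclideanSpace ℝ (Fin d) → ℝ) (h : DampedWave.H1 Ω a b) (α : ℝ) (hα : 0 ≤ α) :
    ∃ U : C0Semigroup (DampedWave.StateSpace Ω b),
      U.generator = DampedWave.dampedWaveOp h α ∧
      ∀ t : ℝ≥0, 0 < t →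
        ‖U.op t‖ ≤ Real.exp
          (2 * (1 + α * |DampedWave.infOn Ω a| + |DampedWave.infOn Ω b|) * (t : ℝ)) := by
  obtain ⟨U, hU, hb⟩ := DampedWave.exists_semigroup_dampedWaveOp h hα
  refine ⟨U, hU, fun t _ => (hb t).trans (Real.exp_le_exp.2 ?_)⟩
  rw [mul_assoc]
  refine le_mul_of_one_le_left (mul_nonneg ?_ t.2) one_le_two
  positivity
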